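/- Let $K$ be a field, let $n\ge 1$, and let $A=N_n^n$ be the path algebra over $K$ of the cyclic quiver $1\to 2\to\cdots\to n\to 1$ modulo the ideal generated by all compositions of $n+1$ consecutive arrows. Write $(i_1\,i_2\cdots i_{l+1})$ for the path starting at $i_1$ and ending at $i_{l+1}$, and multiply paths by concatenation (first path on the left). For a vertex $i$ let $(i)$ be the path of length $0$ at $i$, put $P_i=A(i)$ and ${}_iP=(i)A$, and write $\otimes=\otimes_K$. Let $$\alpha_i: P_i\otimes {}_iP\to A,\qquad x\otimes y\mapsto xy,$$ and let $\beta_i: A\to P_i\otimes{}_iP$ be the homomorphism of $A$-$A$-bimodules with $$\beta_i(1)=\sum_{l=0}^{n} q_l\otimes p_l ,$$ where $p_l$ is the path of length $l$ starting at $i$, and $q_l$ is the path of length $n-l$ which starts at the end of $p_l$ (and hence ends at $i$). Consider the complexes of $A$-$A$-bimodules $$F_i=(0\to P_i\otimes{}_iP\xrightarrow{\ \alpha_i\ }A\to 0),\qquad F_i'=(0\to A\xrightarrow{\ \beta_i\ }P_i\otimes{}_iP\to 0),$$ with $A$ in degree $0$ in both (so $P_i\otimes{}_iP$ is in cohomological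 degree $-1$ in $F_i$ and $1$ in $F_i'$). Two bounded complexes $X,Y$ of $A$-$A$-bimodules (with $K$ acting centrally) are called two-sided tilting complexes inverse to each other if the restrictions of $X$ and of $Y$ to left $A$-modules and to right $A$-modules are perfect (isomorphic in the derived category to bounded complexes of finitely generated projective modules), and $X\otimes_A^{L}Y\simeq A\simeq Y\otimes_A^{L}X$ in the derived category of $A\otimes A^{op}$-modules. The derived Picard group $TrPic(A)$ is the set of isomorphism classes, in this derived category, of the two-sided tilting complexes, with the product induced by $\otimes_A^{L}$. Then for every vertex $i$ the complexes $F_i$ and $F_i'$ are two-sided tilting complexes inverse to each other; in particular their isomorphism classes are elements of $TrPic(A)$. -/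

import Mathlib

open CategoryTheory TensorProduct

universe u

namespace NakayamaTilting

noncomputable section

/-! ### Bimodules over an algebra and their tensor product -/

section Bimodules

variable (K : Type u) [Field K] (A : Type u) [Ring A] [Algebra K A]

/-- The enveloping algebra `A ⊗ Aᵒᵖ`. -/
abbrev Env : Type u := A ⊗[K] Aᵐᵒᵖ

/-- The category of `A`-`A`-bimodules (on which `K` acts centrally). -/
abbrev BimodCat : Type (u + 1) := ModuleCat.{u} (Env K A)

/-- Restriction of a bimodule to a left `A`-module. -/
abbrev leftRes : BimodCat K A ⥤ ModuleCat.{u} A :=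
  ModuleCat.restrictScalars (Algebra.TensorProduct.includeLeft : A →ₐ[K] Env K A).toRingHom

/-- Restriction of a bimodule to a right `A`-module. -/
abbrev rightRes : BimodCat K A ⥤ ModuleCat.{u} Aᵐᵒᵖ :=
  ModuleCat.restrictScalars (Algebra.TensorProduct.includeRight : Aᵐᵒᵖ →ₐ[K] Env K A).toRingHom

/-- The algebra `A`, as an `A`-`A`-bimodule: `(a ⊗ b) • x = a * x * b`. -/
abbrev regularBimod : BimodCat K A :=
  letI : Module (Env K A) A := TensorProduct.Algebra.module
  ModuleCat.of (Env K A) A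

section Outer

variable (M : Type u) [AddCommGroup M] [Module K M] [Module A M] [IsScalarTower K A M]
variable (N : Type u) [AddCommGroup N] [Module K N] [Module Aᵐᵒᵖ N] [IsScalarTower K Aᵐᵒᵖ N]

/-- The tensor product over `K` of a left `A`-module `M` and a right `A`-module `N`, which is an
`A`-`A`-bimodule by `a • (m ⊗ n) • b = (a • m) ⊗ (n • b)`. -/
def Outer (K : Type u) [Field K] (A : Type u) [Ring A] [Algebra K A]
    (M : Type u) [AddCommGroup M] [Module K M] [Module A M] [IsScalarTower K A M]
    (N : Type u) [AddCommGroup N] [Module K N] [Module Aᵐᵒᵖ N] [IsScalarTower K Aᵐᵒᵖ N] :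
    Type u := M ⊗[K] N

instance : AddCommGroup (Outer K A M N) := inferInstanceAs (AddCommGroup (M ⊗[K] N))

/-- The representation of `A ⊗ Aᵒᵖ` on `M ⊗ N`. -/
def outerAction : Env K A →ₐ[K] Module.End K (M ⊗[K] N) :=
  (Module.endTensorEndAlgHom (R := K) (S := K) (A := K) (M := M) (N := N)).comp
    (Algebra.TensorProduct.map (Algebra.lsmul K K M) (Algebra.lsmul K K N))

instance : Module (Env K A) (Outer K A M N) :=
  Module.compHom (M ⊗[K] N) (outerAction K A M N).toRingHom

variable {M N}

/-- The pure tensor `m ⊗ n`. -/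
def Outer.tmul (m : M) (n : N) : Outer K A M N := m ⊗ₜ[K] n

variable {K A}

lemma Outer.smul_tmul (a : A) (b : Aᵐᵒᵖ) (m : M) (n : N) :
    (a ⊗ₜ[K] b : Env K A) • Outer.tmul K A m n = Outer.tmul K A (a • m) (b • n) := rfl

lemma Outer.zero_tmul (n : N) : Outer.tmul K A (0 : M) n = 0 := TensorProduct.zero_tmul _ _

lemma Outer.tmul_zero (m : M) : Outer.tmul K A m (0 : N) = 0 := TensorProduct.tmul_zero _ _

lemma Outer.induction {p : Outer K A M N → Prop} (h0 : p 0)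
    (ht : ∀ m n, p (Outer.tmul K A m n)) (ha : ∀ x y, p x → p y → p (x + y))
    (x : Outer K A M N) : p x :=
  TensorProduct.induction_on (motive := p) x h0 ht ha

variable {M' : Type u} [AddCommGroup M'] [Module K M'] [Module A M'] [IsScalarTower K A M']
variable {N' : Type u} [AddCommGroup N'] [Module K N'] [Module Aᵐᵒᵖ N'] [IsScalarTower K Aᵐᵒᵖ N']

lemma env_linear {V W : Type u} [AddCommGroup V] [AddCommGroup W] [Module (Env K A) V]
    [Module (Env K A) W] (f : V →+ W)
    (h : ∀ (a : A) (b : Aᵐᵒᵖ) (v : V), f ((a ⊗ₜ[K] b : Env K A) • v) = (a ⊗ₜ[K] b : Env K A) • f v)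
    (r : Env K A) (v : V) : f (r • v) = r • f v := by
  induction r using TensorProduct.induction_on with
  | zero =>
    exact (congrArg f (zero_smul (Env K A) v)).trans
      ((map_zero f).trans (zero_smul (Env K A) (f v)).symm)
  | tmul a b => exact h a b v
  | add x y hx hy => rw [add_smul, add_smul, map_add, hx, hy]

/-- The additive map `f ⊗ g`. -/
def Outer.mapAdd (f : M →ₗ[A] M') (g : N →ₗ[Aᵐᵒᵖ] N') : Outer K A M N →+ Outer K A M' N' :=
  (TensorProduct.map (f.restrictScalars K) (g.restrictScalars K)).toAddMonoidHom

/-- The bimodule morphism `f ⊗ g`. -/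
def Outer.map (f : M →ₗ[A] M') (g : N →ₗ[Aᵐᵒᵖ] N') :
    Outer K A M N →ₗ[Env K A] Outer K A M' N' where
  toFun := Outer.mapAdd f g
  map_add' x y := map_add _ x y
  map_smul' := env_linear (Outer.mapAdd f g) (by
      intro a b v
      induction v using Outer.induction with
      | h0 => rw [smul_zero, map_zero, smul_zero]
      | ha x y hx hy => rw [smul_add, map_add, hx, hy, map_add, smul_add]
      | ht m n =>
        rw [Outer.smul_tmul]
        change Outer.tmul K A (f (a • m)) (g (b • n)) = Outer.tmul K A (a • f m) (b • g n)
        rw [map_smul, map_smul])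

lemma Outer.map_tmul (f : M →ₗ[A] M') (g : N →ₗ[Aᵐᵒᵖ] N') (m : M) (n : N) :
    Outer.map (K := K) f g (Outer.tmul K A m n) = Outer.tmul K A (f m) (g n) := rfl

end Outer

section TensorOver

open scoped ModuleCat

variable {K A}

/-- The sub-bimodule of `X ⊗_K Y` generated by the elements `x a ⊗ y - x ⊗ a y`. -/
def balanced (X Y : BimodCat K A) :
    Submodule (Env K A) (Outer K A ((leftRes K A).obj X) ((rightRes K A).obj Y)) :=
  Submodule.span (Env K A) {t | ∃ (x : X) (a : A) (y : Y),
    t = Outer.tmul K A (M := (leftRes K A).obj X) (N := (rightRes K A).obj Y)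
          (((1 : A) ⊗ₜ[K] MulOpposite.op a : Env K A) • x) y
      - Outer.tmul K A (M := (leftRes K A).obj X) (N := (rightRes K A).obj Y)
          x ((a ⊗ₜ[K] (1 : Aᵐᵒᵖ) : Env K A) • y)}

/-- The bimodule `X ⊗_A Y`. -/
abbrev tensorObj (X Y : BimodCat K A) : BimodCat K A :=
  ModuleCat.of (Env K A)
    (Outer K A ((leftRes K A).obj X) ((rightRes K A).obj Y) ⧸ balanced X Y)

/-- The map induced by `f` and `g` on `X ⊗_K Y`. -/
def outerMap {X X' Y Y' : BimodCat K A} (f : X ⟶ X') (g : Y ⟶ Y') :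
    Outer K A ((leftRes K A).obj X) ((rightRes K A).obj Y) →ₗ[Env K A]
      Outer K A ((leftRes K A).obj X') ((rightRes K A).obj Y') :=
  Outer.map ((leftRes K A).map f).hom ((rightRes K A).map g).hom

lemma balanced_le {X X' Y Y' : BimodCat K A} (f : X ⟶ X') (g : Y ⟶ Y') :
    balanced X Y ≤ (balanced X' Y').comap (outerMap f g) := by
  refine Submodule.span_le.2 ?_
  rintro _ ⟨x, a, y, rfl⟩
  refine Submodule.subset_span ⟨f.hom x, a, g.hom y, ?_⟩
  rw [map_sub, ← map_smul, ← map_smul]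
  rfl

/-- The bimodule morphism `f ⊗_A g`. -/
def tensorMap {X X' Y Y' : BimodCat K A} (f : X ⟶ X') (g : Y ⟶ Y') :
    tensorObj X Y ⟶ tensorObj X' Y' :=
  ModuleCat.ofHom (Submodule.mapQ _ _ (outerMap f g) (balanced_le f g))

/-- The class of `x ⊗ y` in `X ⊗_A Y`. -/
def tensorMk {X Y : BimodCat K A} (x : X) (y : Y) : tensorObj X Y :=
  Submodule.Quotient.mk (Outer.tmul K A (M := (leftRes K A).obj X) (N := (rightRes K A).obj Y) x y)

lemma tensorMap_mk {X X' Y Y' : BimodCat K A} (f : X ⟶ X') (g : Y ⟶ Y') (x : X) (y : Y) :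
    (tensorMap f g).hom (tensorMk x y) = tensorMk (f.hom x) (g.hom y) := rfl

lemma tensor_hom_ext {X Y Z : BimodCat K A} {f g : tensorObj X Y ⟶ Z}
    (h : ∀ x y, f.hom (tensorMk x y) = g.hom (tensorMk x y)) : f = g := by
  apply ModuleCat.hom_ext
  apply LinearMap.ext
  intro t
  obtain ⟨t, rfl⟩ := Submodule.Quotient.mk_surjective _ t
  induction t using Outer.induction with
  | h0 => rw [Submodule.Quotient.mk_zero, map_zero, map_zero]
  | ht x y => exact h x y
  | ha x y hx hy => rw [Submodule.Quotient.mk_add, map_add, map_add, hx, hy]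

lemma tensorMk_zero_left {X Y : BimodCat K A} (y : Y) : tensorMk (0 : X) y = 0 := by
  exact (congrArg (Submodule.Quotient.mk (p := balanced X Y)) (Outer.zero_tmul _)).trans
    (Submodule.Quotient.mk_zero _)

lemma tensorMk_zero_right {X Y : BimodCat K A} (x : X) : tensorMk x (0 : Y) = 0 := by
  exact (congrArg (Submodule.Quotient.mk (p := balanced X Y)) (Outer.tmul_zero _)).trans
    (Submodule.Quotient.mk_zero _)

variable (K A)

/-- The bifunctor `(X, Y) ↦ X ⊗_A Y` on bimodules. -/
def tensorBifunctor : BimodCat K A ⥤ BimodCat K A ⥤ BimodCat K A where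
  obj X :=
    { obj := fun Y => tensorObj X Y
      map := fun g => tensorMap (𝟙 X) g
      map_id := fun _ => tensor_hom_ext fun _ _ => rfl
      map_comp := fun _ _ => tensor_hom_ext fun _ _ => rfl }
  map f :=
    { app := fun Y => tensorMap f (𝟙 Y)
      naturality := fun _ _ _ => tensor_hom_ext fun _ _ => rfl }
  map_id X := by
    ext Y : 2
    exact tensor_hom_ext fun x y => rfl
  map_comp f g := by
    ext Y : 2
    exact tensor_hom_ext fun x y => rfl

instance : (tensorBifunctor K A).PreservesZeroMorphisms where
  map_zero X X' := by
    ext Y : 2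
    exact tensor_hom_ext fun x y => tensorMk_zero_left _

instance (X : BimodCat K A) : ((tensorBifunctor K A).obj X).PreservesZeroMorphisms where
  map_zero Y Y' := tensor_hom_ext fun x y => tensorMk_zero_right _

end TensorOver

/-- Cochain complexes of bimodules. -/
abbrev BimodCpx : Type (u + 1) := CochainComplex (BimodCat K A) ℤ

variable {K A} in
/-- The total tensor product `X ⊗_A Y` of two complexes of bimodules. -/
def tensorCpx (X Y : BimodCpx K A) : BimodCpx K A :=
  HomologicalComplex.mapBifunctor X Y (tensorBifunctor K A) (ComplexShape.up ℤ)

/-! ### Derived categories, perfect complexes, two-sided tilting complexes -/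

attribute [local instance] HasDerivedCategory.standard

/-- Two cochain complexes of modules over a ring are isomorphic in the derived category. -/
def DerivedIso {R : Type u} [Ring R] (X Y : CochainComplex (ModuleCat.{u} R) ℤ) : Prop :=
  Nonempty (DerivedCategory.Q.obj X ≅ DerivedCategory.Q.obj Y)

/-- A cochain complex is bounded. -/
def IsBounded {R : Type u} [Ring R] (X : CochainComplex (ModuleCat.{u} R) ℤ) : Prop :=
  ∃ a b : ℤ, X.IsStrictlyGE a ∧ X.IsStrictlyLE b

/-- A perfect complex: one isomorphic, in the derived category, to a bounded complex of finitely
generated projective modules. -/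
def IsPerfect {R : Type u} [Ring R] (X : CochainComplex (ModuleCat.{u} R) ℤ) : Prop :=
  ∃ P : CochainComplex (ModuleCat.{u} R) ℤ, IsBounded P ∧
    (∀ k : ℤ, Module.Finite R (P.X k) ∧ Module.Projective R (P.X k)) ∧ DerivedIso X P

variable {K A}

/-- `X ⊗ᴸ_A Y ≅ Z` in the derived category of bimodules. The derived tensor product is computed
as usual: replace `X` by a quasi-isomorphic bounded above complex `P` of bimodules which are
projective as right `A`-modules, and form `P ⊗_A Y`. -/
def DerivedTensorIso (X Y Z : BimodCpx K A) : Prop :=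
  ∃ (P : BimodCpx K A) (π : P ⟶ X), QuasiIso π ∧ (∃ b : ℤ, P.IsStrictlyLE b) ∧
    (∀ k : ℤ, Module.Projective Aᵐᵒᵖ ((rightRes K A).obj (P.X k))) ∧
    DerivedIso (tensorCpx P Y) Z

variable (K A) in
/-- The bimodule `A`, as a complex concentrated in degree `0`. -/
def unitCpx : BimodCpx K A :=
  (HomologicalComplex.single (BimodCat K A) (ComplexShape.up ℤ) 0).obj (regularBimod K A)

/-- A bounded complex of bimodules whose restrictions to `A` and to `Aᵒᵖ` are perfect. -/
structure IsBiperfect (X : BimodCpx K A) : Prop where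
  bounded : IsBounded X
  left : IsPerfect (((leftRes K A).mapHomologicalComplex (ComplexShape.up ℤ)).obj X)
  right : IsPerfect (((rightRes K A).mapHomologicalComplex (ComplexShape.up ℤ)).obj X)

/-- `X` and `Y` are two-sided tilting complexes inverse to each other. -/
structure AreInverseTilting (X Y : BimodCpx K A) : Prop where
  left : IsBiperfect X
  right : IsBiperfect Y
  tensor_iso : DerivedTensorIso X Y (unitCpx K A)
  tensor_iso' : DerivedTensorIso Y X (unitCpx K A)

/-- `X` is a two-sided tilting complex. -/
def IsTwoSidedTilting (X : BimodCpx K A) : Prop := ∃ Y : BimodCpx K A, AreInverseTilting X Y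

/-- The isomorphism class of a complex of bimodules in the derived category. -/
def isoClass (X : BimodCpx K A) :
    Quotient (isIsomorphicSetoid (DerivedCategory (BimodCat K A))) :=
  Quotient.mk _ (DerivedCategory.Q.obj X)

variable (K A) in
/-- (The underlying set of) the derived Picard group of `A`: the isomorphism classes, in the derived
category of bimodules, of two-sided tilting complexes. -/
def TrPic : Set (Quotient (isIsomorphicSetoid (DerivedCategory (BimodCat K A)))) :=
  {c | ∃ X : BimodCpx K A, IsTwoSidedTilting X ∧ isoClass X = c}

end Bimodules

/-! ### Path algebras -/

section PathAlgebra

/-- All the paths of a quiver. -/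
def AnyPath (V : Type) [Quiver.{0} V] : Type := Σ (a : V) (b : V), Quiver.Path a b

/-- The path algebra `K V` of a quiver with finitely many vertices: the `K`-vector space on the
paths. The product `p * q` of two paths is `p` followed by `q` if `p` ends where `q` starts, and `0`
otherwise. -/
def PathAlgebra (K : Type u) [Field K] (V : Type) [Quiver.{0} V] : Type u := AnyPath V →₀ K

variable (K : Type u) [Field K] (V : Type) [Quiver.{0} V]

instance : AddCommGroup (PathAlgebra K V) := inferInstanceAs (AddCommGroup (AnyPath V →₀ K))
instance : Module K (PathAlgebra K V) := inferInstanceAs (Module K (AnyPath V →₀ K))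

variable {V}

/-- A path, as an element of the path algebra. -/
def PathAlgebra.ofPath {a b : V} (p : Quiver.Path a b) : PathAlgebra K V :=
  Finsupp.single (⟨a, b, p⟩ : AnyPath V) (1 : K)

variable {K}

lemma PathAlgebra.lin_ext {W : Type*} [AddCommGroup W] [Module K W] {f g : PathAlgebra K V →ₗ[K] W}
    (h : ∀ (a b : V) (p : Quiver.Path a b), f (ofPath K p) = g (ofPath K p)) : f = g :=
  Finsupp.lhom_ext' fun p => LinearMap.ext_ring (h p.1 p.2.1 p.2.2)

lemma PathAlgebra.induction {P : PathAlgebra K V → Prop}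
    (zero : P 0) (path : ∀ {a b : V} (p : Quiver.Path a b), P (ofPath K p))
    (add : ∀ x y, P x → P y → P (x + y)) (smul : ∀ (r : K) x, P x → P (r • x))
    (x : PathAlgebra K V) : P x := by
  refine Finsupp.induction_linear (motive := P) x zero add ?_
  intro p r
  have := smul r _ (path p.2.2)
  exact (congrArg P (Finsupp.smul_single_one (p : AnyPath V) r)).mp this

variable [DecidableEq V]

variable (K) in
/-- The product of two paths. -/
def AnyPath.mul (p q : AnyPath V) : PathAlgebra K V :=
  if h : p.2.1 = q.1 then PathAlgebra.ofPath K (p.2.2.comp (q.2.2.cast h.symm rfl)) else 0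

variable (K V) in
/-- The multiplication of the path algebra, as a bilinear map. -/
def PathAlgebra.mulLin : PathAlgebra K V →ₗ[K] PathAlgebra K V →ₗ[K] PathAlgebra K V :=
  Finsupp.lift _ K (AnyPath V) fun p => Finsupp.lift _ K (AnyPath V) fun q => AnyPath.mul K p q

instance : Mul (PathAlgebra K V) := ⟨fun x y => PathAlgebra.mulLin K V x y⟩

namespace PathAlgebra

lemma mul_def (x y : PathAlgebra K V) : x * y = mulLin K V x y := rfl

lemma ofPath_mul_aux (p q : AnyPath V) :
    ofPath K p.2.2 * ofPath K q.2.2 = AnyPath.mul K p q := by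
  have h1 : mulLin K V (ofPath K p.2.2) =
      Finsupp.lift (PathAlgebra K V) K (AnyPath V) fun q => AnyPath.mul K p q := by
    refine (Finsupp.sum_single_index (h := fun p r => r •
      Finsupp.lift (PathAlgebra K V) K (AnyPath V) fun q => AnyPath.mul K p q)
      (zero_smul K _)).trans (one_smul K _)
  rw [mul_def, h1]
  exact (Finsupp.sum_single_index (h := fun q r => r • AnyPath.mul K p q)
      (zero_smul K _)).trans (one_smul K _)

lemma ofPath_mul_ofPath {a b c : V} (p : Quiver.Path a b) (q : Quiver.Path b c) :
    ofPath K p * ofPath K q = ofPath K (p.comp q) := by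
  refine (ofPath_mul_aux ⟨a, b, p⟩ ⟨b, c, q⟩).trans ?_
  simp [AnyPath.mul]

lemma ofPath_mul_ofPath_of_ne {a b c d : V} (p : Quiver.Path a b) (q : Quiver.Path c d)
    (h : b ≠ c) : ofPath K p * ofPath K q = 0 := by
  refine (ofPath_mul_aux ⟨a, b, p⟩ ⟨c, d, q⟩).trans ?_
  simp [AnyPath.mul, h]

lemma add_mul' (x y z : PathAlgebra K V) : (x + y) * z = x * z + y * z := by
  simp only [mul_def, map_add, LinearMap.add_apply]

lemma mul_add' (x y z : PathAlgebra K V) : x * (y + z) = x * y + x * z := by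
  simp only [mul_def, map_add]

lemma smul_mul' (r : K) (x y : PathAlgebra K V) : (r • x) * y = r • (x * y) := by
  simp only [mul_def, map_smul, LinearMap.smul_apply]

lemma mul_smul' (r : K) (x y : PathAlgebra K V) : x * (r • y) = r • (x * y) := by
  simp only [mul_def, map_smul]

lemma zero_mul' (x : PathAlgebra K V) : 0 * x = 0 := by
  simp only [mul_def, map_zero, LinearMap.zero_apply]

lemma mul_zero' (x : PathAlgebra K V) : x * 0 = 0 := by
  simp only [mul_def, map_zero]

variable [Fintype V]

/-- The unit element is the sum of the paths of length `0`. -/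
instance : One (PathAlgebra K V) := ⟨∑ a : V, ofPath K (Quiver.Path.nil : Quiver.Path a a)⟩

lemma one_def : (1 : PathAlgebra K V) = ∑ a : V, ofPath K (Quiver.Path.nil : Quiver.Path a a) := rfl

lemma one_mul' (x : PathAlgebra K V) : 1 * x = x := by
  suffices h : mulLin K V 1 = LinearMap.id from LinearMap.congr_fun h x
  refine lin_ext fun a b p => ?_
  rw [one_def, map_sum, LinearMap.sum_apply, Finset.sum_eq_single a]
  · rw [← mul_def, ofPath_mul_ofPath, Quiver.Path.nil_comp]; rfl
  · intro c _ hc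
    rw [← mul_def, ofPath_mul_ofPath_of_ne _ _ hc]
  · simp

lemma mul_one' (x : PathAlgebra K V) : x * 1 = x := by
  suffices h : (mulLin K V).flip 1 = LinearMap.id from LinearMap.congr_fun h x
  refine lin_ext fun a b p => ?_
  rw [one_def, map_sum, LinearMap.sum_apply, Finset.sum_eq_single b]
  · rw [LinearMap.flip_apply, ← mul_def, ofPath_mul_ofPath, Quiver.Path.comp_nil]; rfl
  · intro c _ hc
    rw [LinearMap.flip_apply, ← mul_def, ofPath_mul_ofPath_of_ne _ _ hc.symm]
  · simp

lemma mul_assoc' (x y z : PathAlgebra K V) : x * y * z = x * (y * z) := by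
  induction x using induction with
  | zero => simp only [zero_mul']
  | add x x' hx hx' => rw [add_mul', add_mul', hx, hx', add_mul']
  | smul r x hx => rw [smul_mul', smul_mul', hx, smul_mul']
  | path p =>
  induction y using induction with
  | zero => simp only [zero_mul', mul_zero']
  | add x x' hx hx' => rw [mul_add', add_mul', hx, hx', add_mul', mul_add']
  | smul r x hx => rw [smul_mul', mul_smul', smul_mul', hx, mul_smul']
  | path q =>
  induction z using induction with
  | zero => simp only [mul_zero']
  | add x x' hx hx' => rw [mul_add', mul_add', hx, hx', mul_add']
  | smul r x hx => rw [mul_smul', mul_smul', hx, mul_smul']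
  | @path c c' s =>
  rename_i a a' b b'
  by_cases h : a' = b
  · subst h
    by_cases h' : b' = c
    · subst h'
      simp only [ofPath_mul_ofPath, Quiver.Path.comp_assoc]
    · rw [ofPath_mul_ofPath, ofPath_mul_ofPath_of_ne _ _ h', ofPath_mul_ofPath_of_ne _ _ h',
        mul_zero']
  · rw [ofPath_mul_ofPath_of_ne _ _ h, zero_mul']
    by_cases h' : b' = c
    · subst h'
      rw [ofPath_mul_ofPath, ofPath_mul_ofPath_of_ne _ _ h]
    · rw [ofPath_mul_ofPath_of_ne _ _ h', mul_zero']

instance : Ring (PathAlgebra K V) where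
  __ := (inferInstance : AddCommGroup (PathAlgebra K V))
  mul_assoc := mul_assoc'
  one_mul := one_mul'
  mul_one := mul_one'
  left_distrib := mul_add'
  right_distrib := add_mul'
  zero_mul := zero_mul'
  mul_zero := mul_zero'

instance : Algebra K (PathAlgebra K V) := Algebra.ofModule smul_mul' mul_smul'

end PathAlgebra
end PathAlgebra

/-! ### The Nakayama algebras -/

section Nakayama

/-- The cyclic quiver `1 → 2 → ⋯ → m → 1`, with the set of vertices `ℤ/m` and exactly one arrow
`j → j + 1` for each vertex `j`. -/
instance cyclicQuiver (m : ℕ) : Quiver.{0} (ZMod m) where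
  Hom a b := PLift (b = a + 1)

/-- The relations of the Nakayama algebra: all paths of length `n + 1` are `0`. -/
inductive NakayamaRel (K : Type u) [Field K] (n m : ℕ) [NeZero m] :
    PathAlgebra K (ZMod m) → PathAlgebra K (ZMod m) → Prop
  | long {a b : ZMod m} (p : Quiver.Path a b) (hp : p.length = n + 1) :
      NakayamaRel K n m (PathAlgebra.ofPath K p) 0

/-- The self-injective Nakayama algebra `N^n_m`: the path algebra of the cyclic quiver with `m`
vertices modulo the ideal generated by all compositions of `n + 1` consecutive arrows. -/
abbrev Nakayama (K : Type u) [Field K] (n m : ℕ) [NeZero m] : Type u :=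
  RingQuot (NakayamaRel K n m)

/-- The path of length `l` starting at `j` in the cyclic quiver. -/
def walk {m : ℕ} (j : ZMod m) : (l : ℕ) → Quiver.Path j (j + (l : ZMod m))
  | 0 => Quiver.Path.nil.cast rfl (by simp)
  | l + 1 => (walk j l).cons ⟨by push_cast; ring⟩

lemma length_walk {m : ℕ} (j : ZMod m) (l : ℕ) : (walk j l).length = l := by
  induction l with
  | zero =>
    have h : ∀ {b : ZMod m} (h : j = b), ((Quiver.Path.nil : Quiver.Path j j).cast rfl h).length = 0 := by
      rintro b rfl; rfl
    exact h _
  | succ l ih => exact congrArg (· + 1) ih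

lemma anyPath_eq_walk {m : ℕ} {a b : ZMod m} (p : Quiver.Path a b) :
    (⟨a, b, p⟩ : AnyPath (ZMod m)) = ⟨a, _, walk a p.length⟩ := by
  induction p with
  | nil =>
    have h : ∀ {b : ZMod m} (h : a = b), (⟨a, a, Quiver.Path.nil⟩ : AnyPath (ZMod m)) =
        ⟨a, b, (Quiver.Path.nil : Quiver.Path a a).cast rfl h⟩ := by
      rintro b rfl; rfl
    exact h _
  | @cons b c p e ih =>
    have key : ∀ (l : ℕ) (b c : ZMod m) (p : Quiver.Path a b) (e : b ⟶ c),
        (⟨a, b, p⟩ : AnyPath (ZMod m)) = ⟨a, _, walk a l⟩ →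
        (⟨a, c, p.cons e⟩ : AnyPath (ZMod m)) = ⟨a, _, walk a (l + 1)⟩ := by
      intro l b c p e h
      have h2 := eq_of_heq (Sigma.mk.inj h).2
      obtain ⟨h3, h4⟩ := Sigma.mk.inj h2
      subst h3
      obtain rfl := eq_of_heq h4
      obtain ⟨e⟩ := e
      have h5 : c = a + ((l + 1 : ℕ) : ZMod m) := by rw [e]; push_cast; ring
      subst h5
      rfl
    exact key _ _ _ _ _ ih

variable (K : Type u) [Field K] (n m : ℕ) [NeZero m]

/-- The class in `N^n_m` of the path of length `l` starting at `j`. -/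
def path (j : ZMod m) (l : ℕ) : Nakayama K n m :=
  RingQuot.mkAlgHom K (NakayamaRel K n m) (PathAlgebra.ofPath K (walk j l))

/-- The idempotent of `N^n_m` given by the path of length `0` at `j`. -/
abbrev idem (j : ZMod m) : Nakayama K n m := path K n m j 0

variable {m}

lemma ofPath_eq_walk {a b : ZMod m} (p : Quiver.Path a b) :
    PathAlgebra.ofPath K p = PathAlgebra.ofPath K (walk a p.length) :=
  congrArg (fun q : AnyPath (ZMod m) => (Finsupp.single q (1 : K) : AnyPath (ZMod m) →₀ K))
    (anyPath_eq_walk p)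

lemma path_mul_path (j j' : ZMod m) (l k : ℕ) (h : j' = j + (l : ZMod m)) :
    path K n m j l * path K n m j' k = path K n m j (l + k) := by
  subst h
  rw [path, path, ← map_mul, PathAlgebra.ofPath_mul_ofPath, ofPath_eq_walk,
    Quiver.Path.length_comp, length_walk, length_walk, path]

lemma path_mul_path_of_ne (j j' : ZMod m) (l k : ℕ) (h : j + (l : ZMod m) ≠ j') :
    path K n m j l * path K n m j' k = 0 := by
  rw [path, path, ← map_mul, PathAlgebra.ofPath_mul_ofPath_of_ne _ _ h, map_zero]

lemma path_eq_zero (j : ZMod m) (l : ℕ) (h : n < l) : path K n m j l = 0 := by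
  obtain ⟨k, rfl⟩ := Nat.exists_eq_add_of_lt h
  have h0 : path K n m j (n + 1) = 0 := by
    rw [path, RingQuot.mkAlgHom_rel K (NakayamaRel.long (walk j (n + 1)) (length_walk _ _)),
      map_zero]
  rw [show n + k + 1 = (n + 1) + k by omega, ← path_mul_path K n j _ (n + 1) k rfl, h0, zero_mul]

lemma nakayama_induction {P : Nakayama K n m → Prop} (zero : P 0)
    (path : ∀ j l, P (path K n m j l)) (add : ∀ x y, P x → P y → P (x + y))
    (smul : ∀ (r : K) x, P x → P (r • x)) (x : Nakayama K n m) : P x := by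
  obtain ⟨x, rfl⟩ := RingQuot.mkAlgHom_surjective K (NakayamaRel K n m) x
  induction x using PathAlgebra.induction with
  | zero => rwa [map_zero]
  | path p => rw [ofPath_eq_walk]; exact path _ _
  | add x y hx hy => rw [map_add]; exact add _ _ hx hy
  | smul r x hx => rw [map_smul]; exact smul _ _ hx

/-- The projective left module `P_i = A (i)`. -/
def leftP (i : ZMod m) : Submodule (Nakayama K n m) (Nakayama K n m) :=
  Submodule.span _ {idem K n m i}

/-- The projective right module `_iP = (i) A`. -/
def rightP (i : ZMod m) : Submodule (Nakayama K n m)ᵐᵒᵖ (Nakayama K n m) :=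
  Submodule.span _ {idem K n m i}

lemma path_mem_leftP (i j : ZMod m) (l : ℕ) (h : j + (l : ZMod m) = i) :
    path K n m j l ∈ leftP K n i :=
  Submodule.mem_span_singleton.2 ⟨path K n m j l, path_mul_path K n j i l 0 h.symm⟩

lemma path_mem_rightP (i : ZMod m) (l : ℕ) : path K n m i l ∈ rightP K n i :=
  Submodule.mem_span_singleton.2 ⟨MulOpposite.op (path K n m i l),
    (path_mul_path K n i i 0 l (by simp)).trans (by rw [zero_add])⟩

/-- The bimodule `P_i ⊗ _iP`. -/
abbrev PP (i : ZMod m) : BimodCat K (Nakayama K n m) :=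
  ModuleCat.of (Env K (Nakayama K n m)) (Outer K (Nakayama K n m) (leftP K n i) (rightP K n i))

/-- The map `x ⊗ y ↦ x y`, as an additive map. -/
def alphaAdd (i : ZMod m) :
    Outer K (Nakayama K n m) (leftP K n i) (rightP K n i) →+ Nakayama K n m :=
  (TensorProduct.lift ((LinearMap.mul K (Nakayama K n m)).compl₁₂
    ((leftP K n i).subtype.restrictScalars K)
    ((rightP K n i).subtype.restrictScalars K))).toAddMonoidHom

/-- The bimodule morphism `α_i : P_i ⊗ _iP → A`, `x ⊗ y ↦ x y`. -/
def alpha (i : ZMod m) : PP K n i ⟶ regularBimod K (Nakayama K n m) :=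
  letI : Module (Env K (Nakayama K n m)) (Nakayama K n m) := TensorProduct.Algebra.module
  ModuleCat.ofHom
    { toFun := alphaAdd K n i
      map_add' := map_add _
      map_smul' := env_linear (alphaAdd K n i) (by
        intro a b v
        induction v using Outer.induction with
        | h0 => rw [smul_zero, map_zero, smul_zero]
        | ha x y hx hy => rw [smul_add, map_add, hx, hy, map_add, smul_add]
        | ht x y =>
          rw [Outer.smul_tmul, TensorProduct.Algebra.smul_def]
          change (a * (x : Nakayama K n m)) * ((y : Nakayama K n m) * b.unop)
            = a * (((x : Nakayama K n m) * (y : Nakayama K n m)) * b.unop)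
          simp only [mul_assoc]) }

lemma alpha_tmul (i : ZMod m) (x : leftP K n i) (y : rightP K n i) :
    (alpha K n i).hom (Outer.tmul K (Nakayama K n m) x y) =
      (x : Nakayama K n m) * (y : Nakayama K n m) := rfl

end Nakayama

section Symmetric

/-! From now on `m = n`. -/

variable (K : Type u) [Field K] {n : ℕ} [NeZero n]

lemma cycle_end (i : ZMod n) (l : Fin (n + 1)) :
    i + ((l : ℕ) : ZMod n) + ((n - (l : ℕ) : ℕ) : ZMod n) = i := by
  rw [add_assoc, ← Nat.cast_add, Nat.add_sub_cancel' (Nat.lt_succ_iff.1 l.2), ZMod.natCast_self,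
    add_zero]

/-- The element `∑ (j ⋯ i) ⊗ (i ⋯ j)` of `P_i ⊗ _iP`, where `(i ⋯ j)` runs over the paths starting
at `i` of length `l = 0, …, n`, and the lengths of `(i ⋯ j)` and `(j ⋯ i)` add up to `n`. -/
def betaOne (i : ZMod n) :
    Outer K (Nakayama K n n) (leftP K n i) (rightP K n i) :=
  ∑ l : Fin (n + 1), Outer.tmul K (Nakayama K n n)
    (⟨path K n n (i + ((l : ℕ) : ZMod n)) (n - l),
      path_mem_leftP K n i _ _ (cycle_end i l)⟩ : leftP K n i)
    (⟨path K n n i l, path_mem_rightP K n i l⟩ : rightP K n i)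

lemma betaOne_central (i : ZMod n) (a : Nakayama K n n) :
    (a ⊗ₜ[K] (1 : (Nakayama K n n)ᵐᵒᵖ) : Env K (Nakayama K n n)) • betaOne K i =
      ((1 : Nakayama K n n) ⊗ₜ[K] MulOpposite.op a : Env K (Nakayama K n n)) • betaOne K i := by
  induction a using nakayama_induction with
  | zero => rw [MulOpposite.op_zero, TensorProduct.zero_tmul, TensorProduct.tmul_zero]
  | add x y hx hy =>
    rw [MulOpposite.op_add, TensorProduct.add_tmul, TensorProduct.tmul_add, add_smul, add_smul,
      hx, hy]
  | smul r x hx =>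
    rw [MulOpposite.op_smul, ← TensorProduct.smul_tmul', TensorProduct.tmul_smul,
      ← smul_one_mul r, mul_smul, hx, ← mul_smul, smul_one_mul]
  | path j k =>
    let A := Nakayama K n n
    -- a total version of the pure tensors
    let T : A → A → Outer K A (leftP K n i) (rightP K n i) := fun x y => Outer.tmul K A
      (⟨x * idem K n n i, Submodule.mem_span_singleton.2 ⟨x, rfl⟩⟩ : leftP K n i)
      (⟨idem K n n i * y, Submodule.mem_span_singleton.2 ⟨MulOpposite.op y, rfl⟩⟩ : rightP K n i)
    have hT : ∀ (x y : A) (hx : x ∈ leftP K n i) (hy : y ∈ rightP K n i),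
        Outer.tmul K A (⟨x, hx⟩ : leftP K n i) (⟨y, hy⟩ : rightP K n i) = T x y := by
      intro x y hx hy
      have hi : idem K n n i * idem K n n i = idem K n n i :=
        path_mul_path K n i i 0 0 (by simp)
      have h1 : x * idem K n n i = x := by
        obtain ⟨z, rfl⟩ := Submodule.mem_span_singleton.1 hx
        rw [smul_eq_mul, mul_assoc, hi]
      have h2 : idem K n n i * y = y := by
        obtain ⟨z, rfl⟩ := Submodule.mem_span_singleton.1 hy
        rw [MulOpposite.smul_eq_mul_unop, ← mul_assoc, hi]
      simp only [T, h1, h2]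
    have hT0 : ∀ y, T 0 y = 0 := fun y => by
      simp only [T, zero_mul]; exact Outer.zero_tmul _
    have hT0' : ∀ x, T x 0 = 0 := fun y => by
      simp only [T, mul_zero]; exact Outer.tmul_zero _
    have hl : (path K n n j k ⊗ₜ[K] (1 : Aᵐᵒᵖ) : Env K A) • betaOne K i =
        ∑ l ∈ Finset.range (n + 1), T (path K n n j k * path K n n (i + (l : ZMod n)) (n - l))
          (path K n n i l) := by
      rw [betaOne, Finset.smul_sum, Finset.sum_range]
      refine Finset.sum_congr rfl fun l _ => ?_
      rw [Outer.smul_tmul, one_smul]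
      exact hT _ _ _ _
    have hr : ((1 : A) ⊗ₜ[K] MulOpposite.op (path K n n j k) : Env K A) • betaOne K i =
        ∑ l ∈ Finset.range (n + 1), T (path K n n (i + (l : ZMod n)) (n - l))
          (path K n n i l * path K n n j k) := by
      rw [betaOne, Finset.smul_sum, Finset.sum_range]
      refine Finset.sum_congr rfl fun l _ => ?_
      rw [Outer.smul_tmul, one_smul]
      exact hT _ _ _ _
    rw [hl, hr]
    by_cases hk : n < k
    · rw [path_eq_zero K n j k hk]
      simp only [zero_mul, mul_zero, hT0, hT0']
    · have e1 : n + 1 = k + (n + 1 - k) := by omega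
      have e2 : n + 1 = (n + 1 - k) + k := by omega
      conv_lhs => rw [e1, Finset.sum_range_add]
      conv_rhs => rw [e2, Finset.sum_range_add]
      rw [Finset.sum_eq_zero (s := Finset.range k), zero_add,
        Finset.sum_eq_zero (s := Finset.range k), add_zero]
      · refine Finset.sum_congr rfl fun l hl => ?_
        rw [Finset.mem_range] at hl
        by_cases h : j = i + (l : ZMod n)
        · subst h
          rw [path_mul_path _ _ _ _ _ _ (by push_cast; ring), path_mul_path _ _ _ _ _ _ rfl]
          congr 2 <;> omega
        · rw [path_mul_path_of_ne _ _ _ _ _ _ (fun h' => h ?_),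
            path_mul_path_of_ne _ _ _ _ _ _ (fun h' => h h'.symm), hT0, hT0']
          push_cast at h'
          linear_combination h'
      · intro l hl
        rw [Finset.mem_range] at hl
        by_cases h : i + ((n + 1 - k + l : ℕ) : ZMod n) = j
        · rw [path_mul_path _ _ _ _ _ _ h.symm, path_eq_zero _ _ _ (n + 1 - k + l + k) (by omega),
            hT0']
        · rw [path_mul_path_of_ne _ _ _ _ _ _ h, hT0']
      · intro l hl
        rw [Finset.mem_range] at hl
        by_cases h : j + (k : ZMod n) = i + (l : ZMod n)
        · rw [path_mul_path _ _ _ _ _ _ h.symm, path_eq_zero _ _ _ (k + (n - l)) (by omega), hT0]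
        · rw [path_mul_path_of_ne _ _ _ _ _ _ h, hT0]

/-- The bimodule morphism `β_i : A → P_i ⊗ _iP` with
`β_i 1 = ∑ (j ⋯ i) ⊗ (i ⋯ j)`. -/
def beta (i : ZMod n) : regularBimod K (Nakayama K n n) ⟶ PP K n i :=
  letI : Module (Env K (Nakayama K n n)) (Nakayama K n n) := TensorProduct.Algebra.module
  ModuleCat.ofHom
    { toFun := fun a => (a ⊗ₜ[K] 1 : Env K (Nakayama K n n)) • betaOne K i
      map_add' := fun x y => by rw [TensorProduct.add_tmul, add_smul]
      map_smul' := env_linear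
        (AddMonoidHom.mk' (fun a : Nakayama K n n =>
          (a ⊗ₜ[K] 1 : Env K (Nakayama K n n)) • betaOne K i)
          (fun x y => by rw [TensorProduct.add_tmul, add_smul])) (by
        intro a b x
        rw [TensorProduct.Algebra.smul_def]
        change ((a * (x * b.unop)) ⊗ₜ[K] 1 : Env K (Nakayama K n n)) • betaOne K i =
          (a ⊗ₜ[K] b : Env K (Nakayama K n n)) •
            (x ⊗ₜ[K] 1 : Env K (Nakayama K n n)) • betaOne K i
        rw [← mul_smul, Algebra.TensorProduct.tmul_mul_tmul, mul_one, ← mul_assoc,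
          show ((a * x * b.unop) ⊗ₜ[K] (1 : (Nakayama K n n)ᵐᵒᵖ) : Env K (Nakayama K n n)) =
            ((a * x) ⊗ₜ[K] 1) * (b.unop ⊗ₜ[K] 1) by
            rw [Algebra.TensorProduct.tmul_mul_tmul, mul_one], mul_smul, betaOne_central,
          ← mul_smul, Algebra.TensorProduct.tmul_mul_tmul, mul_one, one_mul, MulOpposite.op_unop]) }

lemma beta_one (i : ZMod n) : (beta K i).hom (1 : Nakayama K n n) = betaOne K i :=
  one_smul (Env K (Nakayama K n n)) (betaOne K i)

/-- The complex `F_i = (0 → P_i ⊗ _iP → A → 0)` with differential `α_i` and with `A` in degree `0`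
(so that `P_i ⊗ _iP` is in cohomological degree `-1`). -/
def F (i : ZMod n) : BimodCpx K (Nakayama K n n) :=
  HomologicalComplex.double (alpha K n i)
    (show (ComplexShape.up ℤ).Rel (-1) 0 from neg_add_cancel (1 : ℤ))

/-- The complex `F_i' = (0 → A → P_i ⊗ _iP → 0)` with differential `β_i` and with `A` in degree `0`
(so that `P_i ⊗ _iP` is in cohomological degree `1`). -/
def F' (i : ZMod n) : BimodCpx K (Nakayama K n n) :=
  HomologicalComplex.double (beta K i)
    (show (ComplexShape.up ℤ).Rel 0 1 from zero_add (1 : ℤ))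

end Symmetric

end

end NakayamaTilting

/-!
Put `e = (i)`, `Q = A e ⊗ e A`, and let `τ : A → K` be the sum of the coefficients of the paths of
length `n`. The corner `e A e` is spanned by `e` and the full cycle `w`, and `τ(e) = 0`, `τ(w) = 1`.
Since `Q ⊗_A Q = A e ⊗ e A e ⊗ e A` is the sum of two copies of `Q`, the total complex of
`F_i ⊗_A F_i'`, namely `Q → (Q ⊗_A Q) ⊕ A → Q`, contracts onto `A`. Contracting the middle
of `Q ⊗_A Q` with `τ` is a retraction of the first map, because the paths `p_l` and `q_l` are dual
to each other under `(y, x) ↦ τ(y x)`; inserting `e ⊗ e` in the middle is a section of the second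
one, because `α_i` is multiplication. Finally the kernel of the retraction is the image of the
section, because the kernel of `τ` on `e A e` is spanned by `e`. The same works in the other order.
-/

namespace NakayamaTilting

noncomputable section

section ThreeTerm

open Limits

variable {C : Type*} [Category* C] [Preadditive C]

/-- An identification of a cochain complex `T` with the complex `X ⟶ Y ⟶ Z` placed in degrees
`-1`, `0` and `1`. -/
structure ThreeTermModel (T : CochainComplex C ℤ) {X Y Z : C} (f : X ⟶ Y) (g : Y ⟶ Z) where
  isZero_X (k : ℤ) : k ≠ -1 → k ≠ 0 → k ≠ 1 → IsZero (T.X k)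
  isoLeft : T.X (-1) ≅ X
  isoMiddle : T.X 0 ≅ Y
  isoRight : T.X 1 ≅ Z
  d_isoMiddle : T.d (-1) 0 ≫ isoMiddle.hom = isoLeft.hom ≫ f
  d_isoRight : T.d 0 1 ≫ isoRight.hom = isoMiddle.hom ≫ g

/-- The data of a strong deformation retraction of the complex `X ⟶ Y ⟶ Z` onto an object `A`
placed in the middle degree, with homotopies `backLeft` and `backRight`. -/
structure ThreeTermContraction {X Y Z : C} (f : X ⟶ Y) (g : Y ⟶ Z) (A : C) where
  incl : A ⟶ Y
  proj : Y ⟶ A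
  backLeft : Y ⟶ X
  backRight : Z ⟶ Y
  incl_comp : incl ≫ g = 0
  comp_proj : f ≫ proj = 0
  incl_proj : incl ≫ proj = 𝟙 A
  comp_backLeft : f ≫ backLeft = 𝟙 X
  backRight_comp : backRight ≫ g = 𝟙 Z
  middle : g ≫ backRight + backLeft ≫ f + proj ≫ incl = 𝟙 Y

namespace ThreeTermModel

variable {T : CochainComplex C ℤ} {X Y Z A : C} {f : X ⟶ Y} {g : Y ⟶ Z}

/-- Replacing the three terms of a model by isomorphic ones. -/
def ofIso (M : ThreeTermModel T f g) {X' Y' Z' : C} {f' : X' ⟶ Y'} {g' : Y' ⟶ Z'}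
    (x : X ≅ X') (y : Y ≅ Y') (z : Z ≅ Z') (hf : f ≫ y.hom = x.hom ≫ f')
    (hg : g ≫ z.hom = y.hom ≫ g') : ThreeTermModel T f' g' where
  isZero_X := M.isZero_X
  isoLeft := M.isoLeft ≪≫ x
  isoMiddle := M.isoMiddle ≪≫ y
  isoRight := M.isoRight ≪≫ z
  d_isoMiddle := by simp [reassoc_of% M.d_isoMiddle, hf]
  d_isoRight := by simp [reassoc_of% M.d_isoRight, hg]

lemma d_left (M : ThreeTermModel T f g) :
    T.d (-1) 0 = M.isoLeft.hom ≫ f ≫ M.isoMiddle.inv := by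
  rw [← Category.assoc, Iso.eq_comp_inv, M.d_isoMiddle]

lemma d_right (M : ThreeTermModel T f g) :
    T.d 0 1 = M.isoMiddle.hom ≫ g ≫ M.isoRight.inv := by
  rw [← Category.assoc, Iso.eq_comp_inv, M.d_isoRight]

/-- The components of the homotopy on `T` given by maps `s` and `t` going against the differentials
of its three-term model. -/
def homotopyHom (M : ThreeTermModel T f g) (s : Y ⟶ X) (t : Z ⟶ Y) (p q : ℤ) : T.X p ⟶ T.X q :=
  if h : p = 0 ∧ q = -1 then
    (T.XIsoOfEq h.1).hom ≫ M.isoMiddle.hom ≫ s ≫ M.isoLeft.inv ≫ (T.XIsoOfEq h.2).inv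
  else if h : p = 1 ∧ q = 0 then
    (T.XIsoOfEq h.1).hom ≫ M.isoRight.hom ≫ t ≫ M.isoMiddle.inv ≫ (T.XIsoOfEq h.2).inv
  else 0

section

variable (M : ThreeTermModel T f g) (s : Y ⟶ X) (t : Z ⟶ Y)

lemma homotopyHom_zero_neg_one :
    M.homotopyHom s t 0 (-1) = M.isoMiddle.hom ≫ s ≫ M.isoLeft.inv := by
  simp [homotopyHom]

lemma homotopyHom_one_zero :
    M.homotopyHom s t 1 0 = M.isoRight.hom ≫ t ≫ M.isoMiddle.inv := by
  simp [homotopyHom]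

lemma homotopyHom_eq_zero {p q : ℤ} (h : ¬ (p = 0 ∧ q = -1)) (h' : ¬ (p = 1 ∧ q = 0)) :
    M.homotopyHom s t p q = 0 := by
  rw [homotopyHom, dif_neg h, dif_neg h']

end

variable [HasZeroObject C]

/-- The chain map from `T` to `A` given by a map on the middle term. -/
def toSingle (M : ThreeTermModel T f g) (p : Y ⟶ A) (hp : f ≫ p = 0) :
    T ⟶ (HomologicalComplex.single C (ComplexShape.up ℤ) 0).obj A :=
  HomologicalComplex.mkHomToSingle (M.isoMiddle.hom ≫ p) (by
    intro k (hk : k + 1 = 0)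
    obtain rfl : k = -1 := by omega
    rw [reassoc_of% M.d_isoMiddle, hp, comp_zero])

/-- The chain map from `A` to `T` given by a map into the middle term. -/
def fromSingle (M : ThreeTermModel T f g) (i : A ⟶ Y) (hi : i ≫ g = 0) :
    (HomologicalComplex.single C (ComplexShape.up ℤ) 0).obj A ⟶ T :=
  HomologicalComplex.mkHomFromSingle (i ≫ M.isoMiddle.inv) (by
    intro k (hk : 0 + 1 = k)
    obtain rfl : k = 1 := by omega
    rw [M.d_right, Category.assoc, Iso.inv_hom_id_assoc, reassoc_of% hi, zero_comp])

lemma fromSingle_toSingle (M : ThreeTermModel T f g) (c : ThreeTermContraction f g A) :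
    M.fromSingle c.incl c.incl_comp ≫ M.toSingle c.proj c.comp_proj = 𝟙 _ := by
  apply HomologicalComplex.from_single_hom_ext
  simp [fromSingle, toSingle, HomologicalComplex.mkHomFromSingle_f,
    HomologicalComplex.mkHomToSingle_f, reassoc_of% c.incl_proj]

/-- The homotopy between the identity of `T` and the retraction given by a contraction. -/
def homotopyOfContraction (M : ThreeTermModel T f g) (c : ThreeTermContraction f g A) :
    Homotopy (𝟙 T) (M.toSingle c.proj c.comp_proj ≫ M.fromSingle c.incl c.incl_comp) where
  hom := M.homotopyHom c.backLeft c.backRight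
  zero p q hpq := by
    refine M.homotopyHom_eq_zero _ _ ?_ ?_ <;> (rintro ⟨rfl, rfl⟩; simp at hpq)
  comm k := by
    rw [dNext_eq _ (show (ComplexShape.up ℤ).Rel k (k + 1) from rfl),
      prevD_eq _ (show (ComplexShape.up ℤ).Rel (k - 1) k by simp), HomologicalComplex.id_f]
    by_cases hk₀ : k = 0
    · subst hk₀
      change 𝟙 _ = T.d 0 1 ≫ M.homotopyHom _ _ 1 0 + M.homotopyHom _ _ 0 (-1) ≫ T.d (-1) 0 + _
      rw [homotopyHom_one_zero, homotopyHom_zero_neg_one, M.d_left, M.d_right,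
        ← cancel_epi M.isoMiddle.inv, ← cancel_mono M.isoMiddle.hom]
      simpa [toSingle, fromSingle, HomologicalComplex.mkHomFromSingle_f,
        HomologicalComplex.mkHomToSingle_f] using c.middle.symm
    have retraction_eq_zero :
        (M.toSingle c.proj c.comp_proj ≫ M.fromSingle c.incl c.incl_comp).f k = 0 := by
      rw [HomologicalComplex.comp_f,
        (HomologicalComplex.isZero_single_obj_X _ _ _ _ hk₀).eq_of_src
          ((M.fromSingle c.incl c.incl_comp).f k) 0, comp_zero]
    rw [retraction_eq_zero, add_zero]
    by_cases hk₁ : k = 1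
    · subst hk₁
      change 𝟙 _ = _ + M.homotopyHom _ _ 1 0 ≫ T.d 0 1
      rw [homotopyHom_one_zero, M.d_right, M.homotopyHom_eq_zero _ _ (by simp) (by simp)]
      simp [reassoc_of% c.backRight_comp]
    by_cases hk₂ : k = -1
    · subst hk₂
      change 𝟙 _ = T.d (-1) 0 ≫ M.homotopyHom _ _ 0 (-1) + _
      rw [homotopyHom_zero_neg_one, M.d_left, M.homotopyHom_eq_zero _ _ (by simp) (by simp)]
      simp [reassoc_of% c.comp_backLeft]
    exact (M.isZero_X k hk₂ hk₀ hk₁).eq_of_src _ _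

/-- A complex whose three-term model contracts onto `A` is homotopy equivalent to `A`. -/
def homotopyEquivSingle (M : ThreeTermModel T f g) (c : ThreeTermContraction f g A) :
    HomotopyEquiv T ((HomologicalComplex.single C (ComplexShape.up ℤ) 0).obj A) where
  hom := M.toSingle c.proj c.comp_proj
  inv := M.fromSingle c.incl c.incl_comp
  homotopyHomInvId := (M.homotopyOfContraction c).symm
  homotopyInvHomId := Homotopy.ofEq (M.fromSingle_toSingle c)

end ThreeTermModel

variable [HasBinaryBiproducts C]

/-- A square complex `Q ⟶ V ⊞ A ⟶ Q` contracts onto `A` as soon as `V` is split by a retraction `r`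
of `b` and a section `j` of `m`. -/
def ThreeTermContraction.ofSquare {Q V A : C} {b : Q ⟶ V} {α : Q ⟶ A} {m : V ⟶ Q} {β : A ⟶ Q}
    (r : V ⟶ Q) (j : Q ⟶ V) (hbm : b ≫ m + α ≫ β = 0) (hbr : b ≫ r = 𝟙 Q) (hjm : j ≫ m = 𝟙 Q)
    (hjr : j ≫ r = 0) (h : (𝟙 V - r ≫ b) ≫ (𝟙 V - m ≫ j) = 0) :
    ThreeTermContraction (biprod.lift b α) (biprod.desc m β) A where
  incl := biprod.lift (-(β ≫ j)) (𝟙 A)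
  proj := biprod.desc (-(r ≫ α)) (𝟙 A)
  backLeft := biprod.desc r 0
  backRight := biprod.lift j 0
  incl_comp := by simp [hjm]
  comp_proj := by simp [reassoc_of% hbr]
  incl_proj := by simp [reassoc_of% hjr]
  comp_backLeft := by simp [hbr]
  backRight_comp := by simp [hjm]
  middle := by
    have resolution : m ≫ j + r ≫ b + r ≫ α ≫ β ≫ j = 𝟙 V := by
      have hαβ : α ≫ β = - (b ≫ m) := eq_neg_of_add_eq_zero_right hbm
      simp only [Preadditive.sub_comp, Preadditive.comp_sub, Category.id_comp, Category.comp_id,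
        Category.assoc] at h
      simp only [reassoc_of% hαβ, Preadditive.neg_comp, Preadditive.comp_neg, Category.assoc]
      rw [← sub_eq_zero, ← neg_eq_zero, ← h]
      abel
    apply biprod.hom_ext'
    · apply biprod.hom_ext
      · simp [← resolution, add_assoc]
      · simp
    · apply biprod.hom_ext <;> simp

end ThreeTerm

section TotalComplex

open Limits HomologicalComplex

variable {C : Type*} [Category* C] [Preadditive C]

lemma isZero_bifunctor_obj (G : C ⥤ C ⥤ C) [G.PreservesZeroMorphisms]
    [∀ Z, (G.obj Z).PreservesZeroMorphisms] {M N : C} (h : IsZero M ∨ IsZero N) :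
    IsZero ((G.obj M).obj N) := by
  rw [IsZero.iff_id_eq_zero]
  obtain h | h := h
  · have map_id_eq_zero : G.map (𝟙 M) = 0 := by rw [h.eq_of_src (𝟙 M) 0, Functor.map_zero]
    simpa using congrArg (fun t => t.app N) map_id_eq_zero
  · rw [← CategoryTheory.Functor.map_id, h.eq_of_src (𝟙 N) 0, Functor.map_zero]

variable (X Y : CochainComplex C ℤ) (G : C ⥤ C ⥤ C) [G.PreservesZeroMorphisms]
  [∀ Z, (G.obj Z).PreservesZeroMorphisms] [HasMapBifunctor X Y G (ComplexShape.up ℤ)]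

/-- The projection of the total complex of a bifunctor onto one of its summands. -/
def mapBifunctorProj (p q k : ℤ) :
    (mapBifunctor X Y G (ComplexShape.up ℤ)).X k ⟶ (G.obj (X.X p)).obj (Y.X q) :=
  mapBifunctorDesc fun p' q' _ =>
    if h : p' = p ∧ q' = q then eqToHom (by rw [h.1, h.2]) else 0

lemma ι_mapBifunctorProj {p q k : ℤ} (h : p + q = k) :
    ιMapBifunctor X Y G (ComplexShape.up ℤ) p q k h ≫ mapBifunctorProj X Y G p q k = 𝟙 _ := by
  simp [mapBifunctorProj]

lemma ι_mapBifunctorProj_of_ne {p q p' q' k : ℤ} (h : p' + q' = k) (hne : p' ≠ p) :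
    ιMapBifunctor X Y G (ComplexShape.up ℤ) p' q' k h ≫ mapBifunctorProj X Y G p q k = 0 := by
  simp [mapBifunctorProj, hne]

lemma ι_mapBifunctor_d {p q p' q' k k' : ℤ} (hp : p + 1 = p') (hq : q + 1 = q')
    (h : p + q = k) (h₁ : p' + q = k') (h₂ : p + q' = k') :
    ιMapBifunctor X Y G (ComplexShape.up ℤ) p q k h ≫
        (mapBifunctor X Y G (ComplexShape.up ℤ)).d k k' =
      (G.map (X.d p p')).app (Y.X q) ≫ ιMapBifunctor X Y G (ComplexShape.up ℤ) p' q k' h₁ +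
        p.negOnePow • ((G.obj (X.X p)).map (Y.d q q') ≫
          ιMapBifunctor X Y G (ComplexShape.up ℤ) p q' k' h₂) := by
  rw [mapBifunctor.d_eq, Preadditive.comp_add, mapBifunctor.ι_D₁, mapBifunctor.ι_D₂,
    mapBifunctor.d₁_eq X Y G (ComplexShape.up ℤ) (show (ComplexShape.up ℤ).Rel p p' from hp)
      q k' h₁,
    mapBifunctor.d₂_eq X Y G (ComplexShape.up ℤ) p
      (show (ComplexShape.up ℤ).Rel q q' from hq) k' h₂]
  simp

variable {X Y} {a b a' b' : ℤ}

lemma mapBifunctor_hom_ext_of_support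
    (hX : ∀ k, k ≠ a → k ≠ a' → IsZero (X.X k)) (hY : ∀ k, k ≠ b → k ≠ b' → IsZero (Y.X k))
    {k : ℤ} {Z : C} {f g : (mapBifunctor X Y G (ComplexShape.up ℤ)).X k ⟶ Z}
    (h : ∀ p q (h : p + q = k), p = a ∨ p = a' → q = b ∨ q = b' →
      ιMapBifunctor X Y G (ComplexShape.up ℤ) p q k h ≫ f =
        ιMapBifunctor X Y G (ComplexShape.up ℤ) p q k h ≫ g) : f = g := by
  apply mapBifunctor.hom_ext
  intro p q hpq
  by_cases hp : p = a ∨ p = a'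
  · by_cases hq : q = b ∨ q = b'
    · exact h p q hpq hp hq
    · exact (isZero_bifunctor_obj G (Or.inr (hY q (by tauto) (by tauto)))).eq_of_src _ _
  · exact (isZero_bifunctor_obj G (Or.inl (hX p (by tauto) (by tauto)))).eq_of_src _ _

lemma isZero_mapBifunctor_X {k : ℤ}
    (hX : ∀ k, k ≠ a → k ≠ a' → IsZero (X.X k)) (hY : ∀ k, k ≠ b → k ≠ b' → IsZero (Y.X k))
    (hk : ∀ p q, p = a ∨ p = a' → q = b ∨ q = b' → p + q ≠ k) :
    IsZero ((mapBifunctor X Y G (ComplexShape.up ℤ)).X k) := by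
  rw [IsZero.iff_id_eq_zero]
  exact mapBifunctor_hom_ext_of_support G hX hY fun p q h hp hq => absurd h (hk p q hp hq)

/-- In a degree `k` to which only the summand of bidegree `(p, q)` contributes, the total complex
is that summand. -/
def mapBifunctorXIso (hX : ∀ k, k ≠ a → k ≠ a' → IsZero (X.X k))
    (hY : ∀ k, k ≠ b → k ≠ b' → IsZero (Y.X k)) (p q k : ℤ) (h : p + q = k)
    (unique : ∀ p' q', p' + q' = k → p' = a ∨ p' = a' → q' = b ∨ q' = b' → p' = p ∧ q' = q) :
    (mapBifunctor X Y G (ComplexShape.up ℤ)).X k ≅ (G.obj (X.X p)).obj (Y.X q) where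
  hom := mapBifunctorProj X Y G p q k
  inv := ιMapBifunctor X Y G (ComplexShape.up ℤ) p q k h
  hom_inv_id := by
    refine mapBifunctor_hom_ext_of_support G hX hY fun p' q' h' hp' hq' => ?_
    obtain ⟨rfl, rfl⟩ := unique p' q' h' hp' hq'
    rw [reassoc_of% ι_mapBifunctorProj X Y G h', Category.comp_id]
  inv_hom_id := ι_mapBifunctorProj X Y G h

variable [HasBinaryBiproducts C]

/-- The middle term of the total complex of two complexes with two terms each. -/
def mapBifunctorMiddleIso (hX : ∀ k, k ≠ a → k ≠ a' → IsZero (X.X k))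
    (hY : ∀ k, k ≠ b → k ≠ b' → IsZero (Y.X k)) (ha : a ≠ a') (k : ℤ) (h : a + b' = k)
    (h' : a' + b = k) :
    (mapBifunctor X Y G (ComplexShape.up ℤ)).X k ≅
      (G.obj (X.X a)).obj (Y.X b') ⊞ (G.obj (X.X a')).obj (Y.X b) where
  hom := biprod.lift (mapBifunctorProj X Y G a b' k) (mapBifunctorProj X Y G a' b k)
  inv := biprod.desc (ιMapBifunctor X Y G (ComplexShape.up ℤ) a b' k h)
    (ιMapBifunctor X Y G (ComplexShape.up ℤ) a' b k h')
  hom_inv_id := by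
    refine mapBifunctor_hom_ext_of_support G hX hY fun p q hpq hp _ => ?_
    rw [biprod.lift_desc, Preadditive.comp_add, Category.comp_id]
    obtain rfl | rfl := hp
    · obtain rfl : q = b' := by omega
      rw [reassoc_of% ι_mapBifunctorProj X Y G hpq,
        reassoc_of% ι_mapBifunctorProj_of_ne X Y G hpq ha, zero_comp, add_zero]
    · obtain rfl : q = b := by omega
      rw [reassoc_of% ι_mapBifunctorProj X Y G hpq,
        reassoc_of% ι_mapBifunctorProj_of_ne X Y G hpq ha.symm, zero_comp, zero_add]
  inv_hom_id := by
    apply biprod.hom_ext' <;> apply biprod.hom_ext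
    · simpa using ι_mapBifunctorProj X Y G h
    · simpa using ι_mapBifunctorProj_of_ne X Y G h ha
    · simpa using ι_mapBifunctorProj_of_ne X Y G h' ha.symm
    · simpa using ι_mapBifunctorProj X Y G h'

/-- The total complex of two complexes with two terms each, the total degrees being `-1`, `0`
and `1`. -/
def ThreeTermModel.ofSupport (hX : ∀ k, k ≠ a → k ≠ a' → IsZero (X.X k))
    (hY : ∀ k, k ≠ b → k ≠ b' → IsZero (Y.X k)) (ha : a + 1 = a') (hb : b + 1 = b')
    (hab : a + b = -1) :
    ThreeTermModel (mapBifunctor X Y G (ComplexShape.up ℤ))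
      (biprod.lift (a.negOnePow • (G.obj (X.X a)).map (Y.d b b')) ((G.map (X.d a a')).app (Y.X b)))
      (biprod.desc ((G.map (X.d a a')).app (Y.X b'))
        (a'.negOnePow • (G.obj (X.X a')).map (Y.d b b'))) where
  isZero_X k h₁ h₂ h₃ := isZero_mapBifunctor_X G hX hY (by omega)
  isoLeft := mapBifunctorXIso G hX hY a b (-1) hab (by omega)
  isoMiddle := mapBifunctorMiddleIso G hX hY (by omega) 0 (by omega) (by omega)
  isoRight := mapBifunctorXIso G hX hY a' b' 1 (by omega) (by omega)
  d_isoMiddle := by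
    rw [← Iso.eq_comp_inv, Category.assoc, ← Iso.inv_comp_eq]
    refine (ι_mapBifunctor_d X Y G ha hb hab (by omega) (by omega)).trans ?_
    rw [mapBifunctorMiddleIso, biprod.lift_desc, add_comm, Linear.units_smul_comp]
  d_isoRight := by
    have map_Y_d_eq_zero : (G.obj (X.X a)).map (Y.d b' (b' + 1)) = 0 := by
      rw [(hY (b' + 1) (by omega) (by omega)).eq_of_tgt (Y.d b' _) 0, Functor.map_zero]
    have map_X_d_eq_zero : G.map (X.d a' (a' + 1)) = 0 := by
      rw [(hX (a' + 1) (by omega) (by omega)).eq_of_tgt (X.d a' _) 0, Functor.map_zero]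
    rw [← Iso.eq_comp_inv, Category.assoc, ← Iso.inv_comp_eq]
    apply biprod.hom_ext'
    · rw [mapBifunctorMiddleIso, biprod.inl_desc_assoc, biprod.inl_desc_assoc]
      refine (ι_mapBifunctor_d X Y G ha rfl (by omega) (by omega) (by omega)).trans ?_
      rw [map_Y_d_eq_zero, zero_comp, smul_zero, add_zero]
      rfl
    · rw [mapBifunctorMiddleIso, biprod.inr_desc_assoc, biprod.inr_desc_assoc]
      refine (ι_mapBifunctor_d X Y G rfl hb (by omega) (by omega) (by omega)).trans ?_
      rw [map_X_d_eq_zero, zero_app, zero_comp, zero_add, Linear.units_smul_comp]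
      rfl

variable [HasZeroObject C] {X₀ X₁ Y₀ Y₁ : C} (f : X₀ ⟶ X₁) (g : Y₀ ⟶ Y₁)
  (ha : (ComplexShape.up ℤ).Rel a a') (hb : (ComplexShape.up ℤ).Rel b b')
  [HasMapBifunctor (double f ha) (double g hb) G (ComplexShape.up ℤ)]

/-- The total complex of two complexes given by single morphisms. -/
def ThreeTermModel.ofDouble (hab : a + b = -1) :
    ThreeTermModel (mapBifunctor (double f ha) (double g hb) G (ComplexShape.up ℤ))
      (biprod.lift (a.negOnePow • (G.obj X₀).map g) ((G.map f).app Y₀))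
      (biprod.desc ((G.map f).app Y₁) (a'.negOnePow • (G.obj X₁).map g)) :=
  have ha_ne : a ≠ a' := by rintro rfl; simp at ha
  have hb_ne : b ≠ b' := by rintro rfl; simp at hb
  let x₀ := doubleXIso₀ f ha
  let x₁ := doubleXIso₁ f ha ha_ne
  let y₀ := doubleXIso₀ g hb
  let y₁ := doubleXIso₁ g hb hb_ne
  (ofSupport G (isZero_double_X f ha) (isZero_double_X g hb) ha hb hab).ofIso
    ((G.mapIso x₀).app _ ≪≫ (G.obj X₀).mapIso y₀)
    (biprod.mapIso ((G.mapIso x₀).app _ ≪≫ (G.obj X₀).mapIso y₁)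
      ((G.mapIso x₁).app _ ≪≫ (G.obj X₁).mapIso y₀))
    ((G.mapIso x₁).app _ ≪≫ (G.obj X₁).mapIso y₁)
    (by
      rw [double_d f ha ha_ne, double_d g hb hb_ne]
      apply biprod.hom_ext <;>
        simp [x₀, x₁, y₀, y₁, Linear.units_smul_comp, Linear.comp_units_smul])
    (by
      rw [double_d f ha ha_ne, double_d g hb hb_ne]
      apply biprod.hom_ext' <;>
        simp [x₀, x₁, y₀, y₁, Linear.units_smul_comp, Linear.comp_units_smul])

end TotalComplex

section TensorProducts

open scoped ModuleCat

variable {K : Type u} [Field K] {A : Type u} [Ring A] [Algebra K A]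

/-- The bimodule morphism given by an additive map commuting with the action of pure tensors. -/
def bimodHom {X Y : BimodCat K A} (f : X →+ Y)
    (h : ∀ (a : A) (b : Aᵐᵒᵖ) (x : X),
      f ((a ⊗ₜ[K] b : Env K A) • x) = (a ⊗ₜ[K] b : Env K A) • f x) : X ⟶ Y :=
  ModuleCat.ofHom { f with map_smul' := env_linear f h }

lemma algebraMap_tmul_one (k : K) : (algebraMap K A k ⊗ₜ[K] (1 : Aᵐᵒᵖ) : Env K A) =
    (1 : A) ⊗ₜ[K] MulOpposite.op (algebraMap K A k) := by
  rw [Algebra.algebraMap_eq_smul_one, MulOpposite.op_smul, MulOpposite.op_one,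
    TensorProduct.tmul_smul, TensorProduct.smul_tmul']

lemma tensorMk_add_left {X Y : BimodCat K A} (x x' : X) (y : Y) :
    tensorMk (x + x') y = tensorMk x y + tensorMk x' y :=
  congrArg (Submodule.Quotient.mk (p := balanced X Y)) (TensorProduct.add_tmul
    (M := (leftRes K A).obj X) (N := (rightRes K A).obj Y) (R := K) x x' y)

lemma tensorMk_add_right {X Y : BimodCat K A} (x : X) (y y' : Y) :
    tensorMk x (y + y') = tensorMk x y + tensorMk x y' :=
  congrArg (Submodule.Quotient.mk (p := balanced X Y)) (TensorProduct.tmul_add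
    (M := (leftRes K A).obj X) (N := (rightRes K A).obj Y) (R := K) x y y')

/-- The canonical map `X × Y → X ⊗_A Y`, as an additive map in both variables. -/
def tensorMkHom (X Y : BimodCat K A) : X →+ Y →+ tensorObj X Y :=
  AddMonoidHom.mk' (fun x => AddMonoidHom.mk' (tensorMk x) (tensorMk_add_right x))
    fun x x' => by ext y; exact tensorMk_add_left x x' y

lemma tensorMk_balanced {X Y : BimodCat K A} (x : X) (a : A) (y : Y) :
    tensorMk (((1 : A) ⊗ₜ[K] MulOpposite.op a : Env K A) • x) y =
      tensorMk x ((a ⊗ₜ[K] (1 : Aᵐᵒᵖ) : Env K A) • y) :=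
  (Submodule.Quotient.eq (balanced X Y)).2 (Submodule.subset_span ⟨x, a, y, rfl⟩)

section Lift

variable {M : Type u} [AddCommGroup M] [Module K M] [Module A M] [IsScalarTower K A M]
  {N : Type u} [AddCommGroup N] [Module K N] [Module Aᵐᵒᵖ N] [IsScalarTower K Aᵐᵒᵖ N]
  {Z : BimodCat K A} (f : M →+ N →+ Z)
  (hbal : ∀ (k : K) (x : M) (y : N), f (k • x) y = f x (k • y))
  (hlin : ∀ (a : A) (b : Aᵐᵒᵖ) (x : M) (y : N),
    f (a • x) (b • y) = (a ⊗ₜ[K] b : Env K A) • f x y)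

/-- The additive map on `M ⊗_K N` given by a biadditive and `K`-balanced map. -/
def Outer.liftAdd : Outer K A M N →+ Z :=
  TensorProduct.liftAddHom (R := K) (M := M) (N := N) (P := Z) f hbal

include hlin in
lemma Outer.liftAdd_smul (a : A) (b : Aᵐᵒᵖ) (v : Outer K A M N) :
    Outer.liftAdd f hbal ((a ⊗ₜ[K] b : Env K A) • v) =
      (a ⊗ₜ[K] b : Env K A) • Outer.liftAdd f hbal v := by
  induction v using Outer.induction with
  | h0 => rw [smul_zero, map_zero, smul_zero]
  | ha x y hx hy => rw [smul_add, map_add, hx, hy, map_add, smul_add]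
  | ht x y => exact hlin a b x y

/-- The bimodule morphism on `M ⊗_K N` given by a biadditive, `K`-balanced and equivariant map. -/
def Outer.lift : ModuleCat.of (Env K A) (Outer K A M N) ⟶ Z :=
  bimodHom (Outer.liftAdd f hbal) (Outer.liftAdd_smul f hbal hlin)

end Lift

section TensorLift

variable {X Y Z : BimodCat K A} (f : X →+ Y →+ Z)
  (hbal : ∀ (x : X) (a : A) (y : Y), f (((1 : A) ⊗ₜ[K] MulOpposite.op a : Env K A) • x) y =
    f x ((a ⊗ₜ[K] (1 : Aᵐᵒᵖ) : Env K A) • y))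
  (hlin : ∀ (a : A) (b : Aᵐᵒᵖ) (x : X) (y : Y),
    f ((a ⊗ₜ[K] (1 : Aᵐᵒᵖ) : Env K A) • x) (((1 : A) ⊗ₜ[K] b : Env K A) • y) =
      (a ⊗ₜ[K] b : Env K A) • f x y)

include hbal in
lemma map_smul_left_eq_of_balanced (k : K) (x : (leftRes K A).obj X) (y : (rightRes K A).obj Y) :
    f (k • x) y = f x (k • y) := by
  have h := hbal x (algebraMap K A k) y
  rw [← algebraMap_tmul_one k] at h
  conv_rhs at h => rw [algebraMap_tmul_one k]
  exact h

/-- The morphism `X ⊗_A Y ⟶ Z` given by a biadditive, balanced and equivariant map. -/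
def tensorLift : tensorObj X Y ⟶ Z :=
  let g := Outer.lift (M := (leftRes K A).obj X) (N := (rightRes K A).obj Y) f
    (map_smul_left_eq_of_balanced f hbal) hlin
  ModuleCat.ofHom (Submodule.liftQ _ g.hom (Submodule.span_le.2 (by
    rintro _ ⟨x, a, y, rfl⟩
    change g.hom _ = 0
    rw [map_sub, sub_eq_zero]
    exact hbal x a y)))

end TensorLift

section Unit

/-- The action of the enveloping algebra, as an additive map in both variables. -/
def envSMul (X : BimodCat K A) : Env K A →+ X →+ X :=
  AddMonoidHom.mk' (fun r => AddMonoidHom.mk' (fun x => r • x) (smul_add r))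
    (fun r s => by ext x; exact add_smul r s x)

lemma env_smul_smul {X : BimodCat K A} (a c : A) (b d : Aᵐᵒᵖ) (x : X) :
    (a ⊗ₜ[K] b : Env K A) • (c ⊗ₜ[K] d : Env K A) • x = ((a * c) ⊗ₜ[K] (b * d) : Env K A) • x := by
  rw [smul_smul, Algebra.TensorProduct.tmul_mul_tmul]

variable (X : BimodCat K A)

/-- The morphism `A ⊗_A X ⟶ X`, `a ⊗ x ↦ a x`. -/
def tensorLeftUnitHom : tensorObj (regularBimod K A) X ⟶ X :=
  tensorLift
    ((envSMul X).comp (AddMonoidHom.mk' (fun a : A => (a ⊗ₜ[K] (1 : Aᵐᵒᵖ) : Env K A))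
      (fun a b => TensorProduct.add_tmul a b 1)))
    (fun a b x => by
      change ((1 * (a * b) : A) ⊗ₜ[K] (1 : Aᵐᵒᵖ) : Env K A) • x =
        (a ⊗ₜ[K] (1 : Aᵐᵒᵖ) : Env K A) • (b ⊗ₜ[K] (1 : Aᵐᵒᵖ) : Env K A) • x
      rw [env_smul_smul, one_mul, mul_one])
    (fun a b c x => by
      change ((a * (c * 1) : A) ⊗ₜ[K] (1 : Aᵐᵒᵖ) : Env K A) • ((1 : A) ⊗ₜ[K] b : Env K A) • x =
        (a ⊗ₜ[K] b : Env K A) • (c ⊗ₜ[K] (1 : Aᵐᵒᵖ) : Env K A) • x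
      simp only [env_smul_smul, one_mul, mul_one])

/-- The morphism `X ⟶ A ⊗_A X`, `x ↦ 1 ⊗ x`. -/
def tensorLeftUnitInv : X ⟶ tensorObj (regularBimod K A) X :=
  bimodHom (tensorMkHom (regularBimod K A) X (1 : A)) (fun a b x => by
    have h := tensorMk_balanced (X := regularBimod K A) (1 : A) a
      (((1 : A) ⊗ₜ[K] b : Env K A) • x)
    rw [env_smul_smul, mul_one, one_mul] at h
    refine h.symm.trans ?_
    change tensorMk (X := regularBimod K A) (1 * (1 * a) : A) (((1 : A) ⊗ₜ[K] b : Env K A) • x) =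
      tensorMk (X := regularBimod K A) (a * (1 * 1) : A) (((1 : A) ⊗ₜ[K] b : Env K A) • x)
    simp only [one_mul, mul_one])

/-- The unit isomorphism `A ⊗_A X ≅ X`. -/
def tensorLeftUnit : tensorObj (regularBimod K A) X ≅ X where
  hom := tensorLeftUnitHom X
  inv := tensorLeftUnitInv X
  hom_inv_id := tensor_hom_ext fun a x => by
    change tensorMk (X := regularBimod K A) (1 : A) ((a ⊗ₜ[K] (1 : Aᵐᵒᵖ) : Env K A) • x) =
      tensorMk a x
    rw [← tensorMk_balanced]
    change tensorMk (X := regularBimod K A) (1 * (1 * a) : A) x = _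
    rw [one_mul, one_mul]
  inv_hom_id := by
    ext x
    exact one_smul (Env K A) x

/-- The morphism `X ⊗_A A ⟶ X`, `x ⊗ a ↦ x a`. -/
def tensorRightUnitHom : tensorObj X (regularBimod K A) ⟶ X :=
  tensorLift
    (AddMonoidHom.flip ((envSMul X).comp
      (AddMonoidHom.mk' (fun a : A => ((1 : A) ⊗ₜ[K] MulOpposite.op a : Env K A))
        (fun a b => TensorProduct.tmul_add 1 (MulOpposite.op a) (MulOpposite.op b)))))
    (fun x a b => by
      change ((1 : A) ⊗ₜ[K] MulOpposite.op b : Env K A) •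
          ((1 : A) ⊗ₜ[K] MulOpposite.op a : Env K A) • x =
        ((1 : A) ⊗ₜ[K] MulOpposite.op (a * (b * 1)) : Env K A) • x
      rw [env_smul_smul, one_mul, mul_one, MulOpposite.op_mul])
    (fun a b x c => by
      change ((1 : A) ⊗ₜ[K] MulOpposite.op (1 * (c * b.unop)) : Env K A) •
          (a ⊗ₜ[K] (1 : Aᵐᵒᵖ) : Env K A) • x =
        (a ⊗ₜ[K] b : Env K A) • ((1 : A) ⊗ₜ[K] MulOpposite.op c : Env K A) • x
      simp only [env_smul_smul, one_mul, mul_one, MulOpposite.op_mul, MulOpposite.op_unop])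

/-- The morphism `X ⟶ X ⊗_A A`, `x ↦ x ⊗ 1`. -/
def tensorRightUnitInv : X ⟶ tensorObj X (regularBimod K A) :=
  bimodHom ((tensorMkHom X (regularBimod K A)).flip (1 : A)) (fun a b x => by
    have h := tensorMk_balanced (Y := regularBimod K A)
      ((a ⊗ₜ[K] (1 : Aᵐᵒᵖ) : Env K A) • x) b.unop (1 : A)
    rw [env_smul_smul, MulOpposite.op_unop, one_mul, mul_one] at h
    refine h.trans ?_
    change tensorMk (Y := regularBimod K A) ((a ⊗ₜ[K] (1 : Aᵐᵒᵖ) : Env K A) • x)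
        (b.unop * (1 * 1) : A) =
      tensorMk (Y := regularBimod K A) ((a ⊗ₜ[K] (1 : Aᵐᵒᵖ) : Env K A) • x) (1 * (1 * b.unop) : A)
    simp only [one_mul, mul_one])

/-- The unit isomorphism `X ⊗_A A ≅ X`. -/
def tensorRightUnit : tensorObj X (regularBimod K A) ≅ X where
  hom := tensorRightUnitHom X
  inv := tensorRightUnitInv X
  hom_inv_id := tensor_hom_ext fun x a => by
    change tensorMk (Y := regularBimod K A) (((1 : A) ⊗ₜ[K] MulOpposite.op a : Env K A) • x)
      (1 : A) = tensorMk x a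
    rw [tensorMk_balanced]
    change tensorMk (Y := regularBimod K A) x (a * (1 * 1) : A) = _
    rw [mul_one, mul_one]
  inv_hom_id := by
    ext x
    exact one_smul (Env K A) x

variable {X} {Y : BimodCat K A}

lemma tensorLeftUnit_naturality (f : X ⟶ Y) :
    tensorMap (𝟙 (regularBimod K A)) f ≫ (tensorLeftUnit Y).hom = (tensorLeftUnit X).hom ≫ f :=
  tensor_hom_ext fun a x => (map_smul f.hom (a ⊗ₜ[K] (1 : Aᵐᵒᵖ) : Env K A) x).symm

lemma tensorRightUnit_naturality (f : X ⟶ Y) :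
    tensorMap f (𝟙 (regularBimod K A)) ≫ (tensorRightUnit Y).hom = (tensorRightUnit X).hom ≫ f :=
  tensor_hom_ext fun x a => (map_smul f.hom ((1 : A) ⊗ₜ[K] MulOpposite.op a : Env K A) x).symm

variable (K A) in
lemma tensorLeftUnit_eq_tensorRightUnit :
    tensorLeftUnit (regularBimod K A) = tensorRightUnit (regularBimod K A) :=
  Iso.ext (tensor_hom_ext fun a b => by
    change (a * (b * 1) : A) = (1 * (a * b) : A)
    rw [one_mul, mul_one])

end Unit

section Coaction

open Limits

variable {Q : BimodCat K A} (α : Q ⟶ regularBimod K A) (β : regularBimod K A ⟶ Q)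

/-- The morphism `Q ⊗_A Q ⟶ Q`, `x ⊗ y ↦ α(x) y`. -/
def actLeft : tensorObj Q Q ⟶ Q := tensorMap α (𝟙 Q) ≫ (tensorLeftUnit Q).hom

/-- The morphism `Q ⊗_A Q ⟶ Q`, `x ⊗ y ↦ x α(y)`. -/
def actRight : tensorObj Q Q ⟶ Q := tensorMap (𝟙 Q) α ≫ (tensorRightUnit Q).hom

/-- The morphism `Q ⟶ Q ⊗_A Q`, `x ↦ β(1) ⊗ x`. -/
def coactLeft : Q ⟶ tensorObj Q Q := (tensorLeftUnit Q).inv ≫ tensorMap β (𝟙 Q)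

/-- The morphism `Q ⟶ Q ⊗_A Q`, `x ↦ x ⊗ β(1)`. -/
def coactRight : Q ⟶ tensorObj Q Q := (tensorRightUnit Q).inv ≫ tensorMap (𝟙 Q) β

lemma coactRight_actLeft : coactRight β ≫ actLeft α = α ≫ β := by
  have interchange : tensorMap (𝟙 Q) β ≫ tensorMap α (𝟙 Q) =
      tensorMap α (𝟙 (regularBimod K A)) ≫ tensorMap (𝟙 (regularBimod K A)) β :=
    tensor_hom_ext fun _ _ => rfl
  rw [coactRight, actLeft, Category.assoc, reassoc_of% interchange, tensorLeftUnit_naturality,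
    Iso.inv_comp_eq, tensorLeftUnit_eq_tensorRightUnit, reassoc_of% tensorRightUnit_naturality α]

lemma coactLeft_actRight : coactLeft β ≫ actRight α = α ≫ β := by
  have interchange : tensorMap β (𝟙 Q) ≫ tensorMap (𝟙 Q) α =
      tensorMap (𝟙 (regularBimod K A)) α ≫ tensorMap β (𝟙 (regularBimod K A)) :=
    tensor_hom_ext fun _ _ => rfl
  rw [coactLeft, actRight, Category.assoc, reassoc_of% interchange, tensorRightUnit_naturality,
    Iso.inv_comp_eq, ← tensorLeftUnit_eq_tensorRightUnit, reassoc_of% tensorLeftUnit_naturality α]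

/-- The tensor product of two complexes concentrated in two consecutive degrees. -/
def ThreeTermModel.ofTensorDouble {X₀ X₁ Y₀ Y₁ : BimodCat K A} (f : X₀ ⟶ X₁) (g : Y₀ ⟶ Y₁)
    {a a' b b' : ℤ} (ha : (ComplexShape.up ℤ).Rel a a') (hb : (ComplexShape.up ℤ).Rel b b')
    (hab : a + b = -1) :
    ThreeTermModel (tensorCpx (HomologicalComplex.double f ha) (HomologicalComplex.double g hb))
      (biprod.lift (a.negOnePow • tensorMap (𝟙 X₀) g) (tensorMap f (𝟙 Y₀)))
      (biprod.desc (tensorMap f (𝟙 Y₁)) (a'.negOnePow • tensorMap (𝟙 X₁) g)) :=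
  ofDouble (tensorBifunctor K A) f g ha hb hab

/-- The tensor product of `Q ⟶ A` (degrees `-1`, `0`) and `A ⟶ Q` (degrees `0`, `1`). -/
def ThreeTermModel.tensorDouble (ha : (ComplexShape.up ℤ).Rel (-1) 0)
    (hb : (ComplexShape.up ℤ).Rel 0 1) :
    ThreeTermModel
      (tensorCpx (HomologicalComplex.double α ha) (HomologicalComplex.double β hb))
      (biprod.lift (-coactRight β) α) (biprod.desc (actLeft α) β) :=
  (ofTensorDouble α β ha hb (add_zero _)).ofIso (tensorRightUnit Q)
    (biprod.mapIso (Iso.refl _) (tensorRightUnit _)) (tensorLeftUnit Q)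
    (by
      apply biprod.hom_ext
      · simp [coactRight]
      · simp [tensorRightUnit_naturality])
    (by
      apply biprod.hom_ext'
      · simp [actLeft]
      · simp [← tensorLeftUnit_eq_tensorRightUnit, tensorLeftUnit_naturality])

/-- The tensor product of `A ⟶ Q` (degrees `0`, `1`) and `Q ⟶ A` (degrees `-1`, `0`). -/
def ThreeTermModel.tensorDouble' (ha : (ComplexShape.up ℤ).Rel 0 1)
    (hb : (ComplexShape.up ℤ).Rel (-1) 0) :
    ThreeTermModel
      (tensorCpx (HomologicalComplex.double β ha) (HomologicalComplex.double α hb))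
      (biprod.lift (coactLeft β) α) (biprod.desc (-actRight α) β) :=
  (ofTensorDouble β α ha hb (zero_add _)).ofIso (tensorLeftUnit Q)
    (biprod.mapIso (tensorRightUnit _) (Iso.refl _) ≪≫ biprod.braiding _ _) (tensorRightUnit Q)
    (by
      apply biprod.hom_ext
      · simp [coactLeft]
      · simp [← tensorLeftUnit_eq_tensorRightUnit, tensorLeftUnit_naturality])
    (by
      apply biprod.hom_ext'
      · simp [tensorRightUnit_naturality]
      · simp [actRight])

end Coaction

end TensorProducts

section OuterProducts

variable {K : Type u} [Field K] {A : Type u} [Ring A] [Algebra K A]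
  {M : Type u} [AddCommGroup M] [Module K M] [Module A M] [IsScalarTower K A M]
  {N : Type u} [AddCommGroup N] [Module K N] [Module Aᵐᵒᵖ N] [IsScalarTower K Aᵐᵒᵖ N]
  {M' : Type u} [AddCommGroup M'] [Module K M'] [Module A M'] [IsScalarTower K A M']
  {N' : Type u} [AddCommGroup N'] [Module K N'] [Module Aᵐᵒᵖ N'] [IsScalarTower K Aᵐᵒᵖ N']

variable (K A M N) in
/-- The bimodule `M ⊗_K N`, as an object of the category of bimodules. -/
abbrev outerBimod : BimodCat K A := ModuleCat.of (Env K A) (Outer K A M N)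

/-- The map `M × N → M ⊗_K N`, as an additive map in both variables. -/
def Outer.tmulHom : M →+ N →+ Outer K A M N :=
  AddMonoidHom.mk' (fun x => AddMonoidHom.mk' (Outer.tmul K A x) (TensorProduct.tmul_add x))
    fun x x' => by ext y; exact TensorProduct.add_tmul x x' y

lemma Outer.smul_tmul_comm (k : K) (x : M) (y : N) :
    Outer.tmul K A (k • x) y = Outer.tmul K A x (k • y) :=
  TensorProduct.smul_tmul k x y

lemma outerBimod_induction {p : outerBimod K A M N → Prop} (zero : p 0)
    (tmul : ∀ x y, p (Outer.tmul K A x y)) (add : ∀ s t, p s → p t → p (s + t))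
    (t : outerBimod K A M N) : p t :=
  Outer.induction (K := K) (A := A) (M := M) (N := N) (p := p) zero tmul add t

lemma Outer.hom_ext {Z : BimodCat K A} {f g : outerBimod K A M N ⟶ Z}
    (h : ∀ x y, f.hom (Outer.tmul K A x y) = g.hom (Outer.tmul K A x y)) : f = g := by
  ext t
  induction t using outerBimod_induction with
  | zero => rw [map_zero, map_zero]
  | add s s' hs hs' => rw [map_add, map_add, hs, hs']
  | tmul x y => exact h x y

lemma Outer.biadd_ext {Z : Type*} [AddCommGroup Z]
    {f g : outerBimod K A M N →+ outerBimod K A M' N' →+ Z}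
    (h : ∀ x c d y, f (Outer.tmul K A x c) (Outer.tmul K A d y) =
      g (Outer.tmul K A x c) (Outer.tmul K A d y)) : f = g := by
  ext s t
  induction s using outerBimod_induction with
  | zero => simp only [map_zero, AddMonoidHom.zero_apply]
  | add s s' hs hs' => simp only [map_add, AddMonoidHom.add_apply, hs, hs']
  | tmul x c =>
    induction t using outerBimod_induction with
    | zero => simp only [map_zero]
    | add t t' ht ht' => simp only [map_add, ht, ht']
    | tmul d y => exact h x c d y

section Contract

variable (B : N →ₗ[K] M' →ₗ[K] K)

variable (M N') in
/-- The map `(x ⊗ c) ⊗ (d ⊗ y) ↦ x ⊗ B(c, d) y`, as a linear map in both variables. -/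
def contractLin : M ⊗[K] N →ₗ[K] M' ⊗[K] N' →ₗ[K] M ⊗[K] N' :=
  TensorProduct.curry (LinearMap.lTensor M
    ((TensorProduct.lid K N').toLinearMap ∘ₗ
      LinearMap.rTensor N' (TensorProduct.lift B) ∘ₗ
      (TensorProduct.assoc K N M' N').symm.toLinearMap) ∘ₗ
    (TensorProduct.assoc K M N (M' ⊗[K] N')).toLinearMap)

variable (M N') in
/-- The additive version of `contractLin` on the underlying bimodules. -/
def contractAdd : outerBimod K A M N →+ outerBimod K A M' N' →+ outerBimod K A M N' :=
  AddMonoidHom.mk' (fun s => (contractLin M N' B s).toAddMonoidHom) fun s s' => by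
    ext t
    exact LinearMap.congr_fun (map_add (contractLin M N' B) s s') t

variable (hB : ∀ (a : A) (c : N) (d : M'), B (MulOpposite.op a • c) d = B c (a • d))

variable (M N') in
/-- The morphism `(M ⊗_K N) ⊗_A (M' ⊗_K N') ⟶ M ⊗_K N'` contracting the two middle factors with
a balanced bilinear form. -/
def contract : tensorObj (outerBimod K A M N) (outerBimod K A M' N') ⟶ outerBimod K A M N' :=
  tensorLift (contractAdd M N' B)
    (fun s a t => by
      have balanced : (contractAdd M N' B).comp (envSMul (outerBimod K A M N)
            (1 ⊗ₜ[K] MulOpposite.op a)) =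
          (contractAdd M N' B).compl₂ (envSMul (outerBimod K A M' N') (a ⊗ₜ[K] 1)) :=
        Outer.biadd_ext fun x c d y => by
          change Outer.tmul K A ((1 : A) • x) (B (MulOpposite.op a • c) d • y) =
            Outer.tmul K A x (B c (a • d) • (1 : Aᵐᵒᵖ) • y)
          rw [one_smul, one_smul, hB]
      exact DFunLike.congr_fun (DFunLike.congr_fun balanced s) t)
    (fun a b s t => by
      have equivariant : ((contractAdd M N' B).comp (envSMul (outerBimod K A M N)
            (a ⊗ₜ[K] 1))).compl₂ (envSMul (outerBimod K A M' N') (1 ⊗ₜ[K] b)) =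
          (contractAdd M N' B).compr₂ (envSMul (outerBimod K A M N') (a ⊗ₜ[K] b)) :=
        Outer.biadd_ext fun x c d y => by
          change Outer.tmul K A (a • x) (B ((1 : Aᵐᵒᵖ) • c) ((1 : A) • d) • b • y) =
            Outer.tmul K A (a • x) (b • B c d • y)
          rw [one_smul, one_smul, smul_comm]
      exact DFunLike.congr_fun (DFunLike.congr_fun equivariant s) t)

end Contract

/-- The element `(x ⊗ c) ⊗ (d ⊗ y)` of `(M ⊗_K N) ⊗_A (M' ⊗_K N')`. -/
def tensorMk₄ (x : M) (c : N) (d : M') (y : N') :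
    tensorObj (outerBimod K A M N) (outerBimod K A M' N') :=
  tensorMk (X := outerBimod K A M N) (Y := outerBimod K A M' N')
    (Outer.tmul K A x c) (Outer.tmul K A d y)

lemma tensorMk₄_balanced (x : M) (c : N) (a : A) (d : M') (y : N') :
    (tensorMk₄ x (MulOpposite.op a • c) d y :
        tensorObj (outerBimod K A M N) (outerBimod K A M' N')) =
      tensorMk₄ x c (a • d) y := by
  have h := tensorMk_balanced (X := outerBimod K A M N) (Y := outerBimod K A M' N')
    (Outer.tmul K A x c) a (Outer.tmul K A d y)
  rwa [Outer.smul_tmul, Outer.smul_tmul, one_smul, one_smul] at h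

lemma tensorMk₄_add (x : M) (c c' : N) (d : M') (y : N') :
    (tensorMk₄ x (c + c') d y : tensorObj (outerBimod K A M N) (outerBimod K A M' N')) =
      tensorMk₄ x c d y + tensorMk₄ x c' d y :=
  (congrArg (fun s => tensorMk (X := outerBimod K A M N) (Y := outerBimod K A M' N') s
    (Outer.tmul K A d y)) (map_add (Outer.tmulHom x) c c')).trans (tensorMk_add_left _ _ _)

lemma tensorMk₄_smul_left (k : K) (x : M) (c : N) (d : M') (y : N') :
    (tensorMk₄ (k • x) c d y : tensorObj (outerBimod K A M N) (outerBimod K A M' N')) =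
      tensorMk₄ x (k • c) d y := by
  rw [tensorMk₄, Outer.smul_tmul_comm, tensorMk₄]

lemma tensorMk₄_smul_right (k : K) (x : M) (c : N) (d : M') (y : N') :
    (tensorMk₄ x c d (k • y) : tensorObj (outerBimod K A M N) (outerBimod K A M' N')) =
      tensorMk₄ x (k • c) d y := by
  rw [tensorMk₄, ← Outer.smul_tmul_comm k d y, ← algebraMap_smul Aᵐᵒᵖ k c,
    ← algebraMap_smul A k d]
  exact (tensorMk₄_balanced x c (algebraMap K A k) d y).symm

variable (K A M N') in
/-- The morphism `M ⊗_K N' ⟶ (M ⊗_K N) ⊗_A (M' ⊗_K N')`, `x ⊗ y ↦ (x ⊗ c) ⊗ (d ⊗ y)`. -/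
def insert (c : N) (d : M') :
    outerBimod K A M N' ⟶ tensorObj (outerBimod K A M N) (outerBimod K A M' N') :=
  Outer.lift
    (((tensorMkHom (outerBimod K A M N) (outerBimod K A M' N')).comp
      (Outer.tmulHom.flip c)).compl₂ (Outer.tmulHom d))
    (fun k x y => (tensorMk₄_smul_left k x c d y).trans (tensorMk₄_smul_right k x c d y).symm)
    (fun a b x y => by
      change tensorMk₄ (a • x) c d (b • y) =
        tensorMk₄ (a • x) ((1 : Aᵐᵒᵖ) • c) ((1 : A) • d) (b • y)
      rw [one_smul, one_smul])

lemma tensorMk₄_induction {p : tensorObj (outerBimod K A M N) (outerBimod K A M' N') → Prop}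
    (zero : p 0) (mk : ∀ x c d y, p (tensorMk₄ x c d y)) (add : ∀ s t, p s → p t → p (s + t))
    (t : tensorObj (outerBimod K A M N) (outerBimod K A M' N')) : p t := by
  have tensor (s : outerBimod K A M N) (t : outerBimod K A M' N') : p (tensorMk s t) := by
    induction s using outerBimod_induction with
    | zero => rw [tensorMk_zero_left]; exact zero
    | add s s' hs hs' => rw [tensorMk_add_left]; exact add _ _ hs hs'
    | tmul x c =>
      induction t using outerBimod_induction with
      | zero => rw [tensorMk_zero_right]; exact zero
      | add t t' ht ht' => rw [tensorMk_add_right]; exact add _ _ ht ht'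
      | tmul d y => exact mk x c d y
  obtain ⟨t, rfl⟩ := Submodule.Quotient.mk_surjective _ t
  induction t using outerBimod_induction with
  | zero => exact zero
  | add s t hs ht => exact add _ _ hs ht
  | tmul s t => exact tensor s t

end OuterProducts

section SphericalIdempotents

open Limits

variable (K : Type u) [Field K] {A : Type u} [Ring A] [Algebra K A]

/-- The left ideal `A e`. -/
abbrev leftIdeal (e : A) : Submodule A A := Submodule.span A {e}

/-- The right ideal `e A`. -/
abbrev rightIdeal (e : A) : Submodule Aᵐᵒᵖ A := Submodule.span Aᵐᵒᵖ {e}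

/-- An idempotent `e` together with a linear form which vanishes at `e`, pairs `e A` and `A e`
perfectly, and whose kernel on `e A e` is spanned by `e`. The pairing is witnessed by the dual
families `right` in `e A` and `left` in `A e`, while `socle` completes `e` to a spanning set of
`e A e`. If `e ≠ 0`, the endomorphism algebra of `A e` is thus two-dimensional, and `A e` is a
`0`-spherical object. -/
structure SphericalIdempotent (e : A) (ι : Type) [Fintype ι] where
  form : A →ₗ[K] K
  socle : rightIdeal e
  left : ι → leftIdeal e
  right : ι → rightIdeal e
  mul_self : e * e = e
  form_self : form e = 0
  corner (a : A) : ∃ k : K, e * a * e = form (e * a * e) • (socle : A) + k • e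
  sum_left (x : leftIdeal e) : ∑ l, form (right l * x) • left l = x
  sum_right (y : rightIdeal e) : ∑ l, form (y * left l) • right l = y

/-- The vector `v`, as an element of the submodule it generates. -/
abbrev generator {R V : Type u} [Semiring R] [AddCommMonoid V] [Module R V] (v : V) :
    Submodule.span R {v} :=
  ⟨v, Submodule.mem_span_singleton_self v⟩

/-- The bimodule `A e ⊗_K e A`. -/
abbrev idemBimod (e : A) : BimodCat K A := outerBimod K A (leftIdeal e) (rightIdeal e)

namespace SphericalIdempotent

variable {K} {e : A} {ι : Type} [Fintype ι] (S : SphericalIdempotent K e ι)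

section Ideals

include S

lemma mul_self_of_mem_leftIdeal (x : leftIdeal e) : (x : A) * e = x := by
  obtain ⟨a, ha⟩ := Submodule.mem_span_singleton.1 x.2
  rw [← ha, smul_eq_mul, mul_assoc, S.mul_self]

lemma self_mul_of_mem_rightIdeal (y : rightIdeal e) : e * (y : A) = y := by
  obtain ⟨a, ha⟩ := Submodule.mem_span_singleton.1 y.2
  rw [← ha, MulOpposite.smul_eq_mul_unop, ← mul_assoc, S.mul_self]

lemma finite_leftIdeal : Module.Finite K (leftIdeal e) := by
  classical
  refine ⟨⟨Finset.univ.image S.left, top_unique fun x _ => ?_⟩⟩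
  rw [← S.sum_left x]
  exact Submodule.sum_mem _ fun l _ => Submodule.smul_mem _ _ (Submodule.subset_span (by simp))

lemma finite_rightIdeal : Module.Finite K (rightIdeal e) := by
  classical
  refine ⟨⟨Finset.univ.image S.right, top_unique fun y _ => ?_⟩⟩
  rw [← S.sum_right y]
  exact Submodule.sum_mem _ fun l _ => Submodule.smul_mem _ _ (Submodule.subset_span (by simp))

lemma projective_leftIdeal : Module.Projective A (leftIdeal e) :=
  Module.Projective.of_split (leftIdeal e).subtype
    (LinearMap.toSpanSingleton A (leftIdeal e) (generator e))
    (LinearMap.ext fun x => Subtype.ext (S.mul_self_of_mem_leftIdeal x))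

lemma exists_mul_eq (y : rightIdeal e) (x : leftIdeal e) :
    ∃ k : K, (y * x : A) = S.form (y * x) • (S.socle : A) + k • e := by
  have h := S.corner (y * x)
  rwa [← mul_assoc e, S.self_mul_of_mem_rightIdeal, mul_assoc (y : A),
    S.mul_self_of_mem_leftIdeal] at h

lemma projective_rightIdeal : Module.Projective Aᵐᵒᵖ (rightIdeal e) :=
  Module.Projective.of_split
    ((MulOpposite.opLinearEquiv Aᵐᵒᵖ : A ≃ₗ[Aᵐᵒᵖ] Aᵐᵒᵖ).toLinearMap ∘ₗ (rightIdeal e).subtype)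
    (LinearMap.toSpanSingleton Aᵐᵒᵖ (rightIdeal e) (generator e))
    (LinearMap.ext fun y => Subtype.ext (S.self_mul_of_mem_rightIdeal y))

end Ideals

/-- The pairing of `e A` and `A e` given by the form. -/
def pairing : rightIdeal e →ₗ[K] leftIdeal e →ₗ[K] K :=
  ((LinearMap.mul K A).compl₁₂ ((rightIdeal e).subtype.restrictScalars K)
    ((leftIdeal e).subtype.restrictScalars K)).compr₂ S.form

/-- The morphism `(x ⊗ c) ⊗ (d ⊗ y) ↦ x ⊗ form(c d) y`. -/
def contraction : tensorObj (idemBimod K e) (idemBimod K e) ⟶ idemBimod K e :=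
  contract (leftIdeal e) (rightIdeal e) S.pairing fun a c d =>
    congrArg S.form (mul_assoc (c : A) a (d : A))

variable (K e) in
/-- The morphism `x ⊗ y ↦ (x ⊗ e) ⊗ (e ⊗ y)`. -/
def insertion : idemBimod K e ⟶ tensorObj (idemBimod K e) (idemBimod K e) :=
  insert K A (leftIdeal e) (rightIdeal e) (generator e) (generator e)

/-- The morphism `x ⊗ y ↦ (x ⊗ w) ⊗ (e ⊗ y)`. -/
def socleInsertion : idemBimod K e ⟶ tensorObj (idemBimod K e) (idemBimod K e) :=
  insert K A (leftIdeal e) (rightIdeal e) S.socle (generator e)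

lemma insertion_contraction : insertion K e ≫ S.contraction = 0 :=
  Outer.hom_ext fun x y => by
    change Outer.tmul K A x (S.form (e * e) • y) = 0
    rw [S.mul_self, S.form_self, zero_smul, Outer.tmul_zero]

/-- Balancing moves `d` across the middle tensor sign, and `c d` lies in the corner `e A e`. -/
lemma sub_socleInsertion_contraction_mem_range
    (t : tensorObj (idemBimod K e) (idemBimod K e)) :
    t - S.socleInsertion.hom (S.contraction.hom t) ∈ LinearMap.range (insertion K e).hom := by
  induction t using tensorMk₄_induction with
  | zero => rw [map_zero, map_zero, sub_zero]; exact zero_mem _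
  | add s t hs ht => rw [map_add, map_add, add_sub_add_comm]; exact add_mem hs ht
  | mk x c d y =>
    obtain ⟨k, hk⟩ := S.exists_mul_eq c d
    refine ⟨Outer.tmul K A (k • x) y, ?_⟩
    have mul_eq : MulOpposite.op (d : A) • c = S.form (c * d) • S.socle + k • generator e :=
      Subtype.ext hk
    have eq_smul : d = (d : A) • generator e := Subtype.ext (S.mul_self_of_mem_leftIdeal d).symm
    calc tensorMk₄ (k • x) (generator e) (generator e) y
      _ = tensorMk₄ x (MulOpposite.op (d : A) • c) (generator e) y -
          tensorMk₄ x (S.form (c * d) • S.socle) (generator e) y := by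
        rw [mul_eq, tensorMk₄_add, add_sub_cancel_left, tensorMk₄_smul_left]
      _ = tensorMk₄ x c d y - tensorMk₄ x S.socle (generator e) (S.form (c * d) • y) := by
        rw [tensorMk₄_balanced, ← eq_smul, tensorMk₄_smul_right]

lemma comp_eq_zero_of_contraction {b : idemBimod K e ⟶ tensorObj (idemBimod K e) (idemBimod K e)}
    {m : tensorObj (idemBimod K e) (idemBimod K e) ⟶ idemBimod K e}
    (hb : b ≫ S.contraction = 𝟙 _) (hm : insertion K e ≫ m = 𝟙 _) :
    (𝟙 _ - S.contraction ≫ b) ≫ (𝟙 _ - m ≫ insertion K e) = 0 := by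
  refine ModuleCat.hom_ext (LinearMap.ext fun t => ?_)
  set t' := t - b.hom (S.contraction.hom t) with ht'
  have contraction_eq_zero : S.contraction.hom t' = 0 := by
    have := congrArg (fun f => f.hom (S.contraction.hom t)) hb
    rw [ht', map_sub, sub_eq_zero]
    exact this.symm
  obtain ⟨s, hs⟩ := S.sub_socleInsertion_contraction_mem_range t'
  rw [contraction_eq_zero, map_zero, sub_zero] at hs
  change t' - (insertion K e).hom (m.hom t') = 0
  rw [← hs, sub_eq_zero]
  exact congrArg (fun f => (insertion K e).hom (f.hom s)) hm.symm

section Actions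

variable {α : idemBimod K e ⟶ regularBimod K A}
  (hα : ∀ (x : leftIdeal e) (y : rightIdeal e), α.hom (Outer.tmul K A x y) = (x * y : A))

include S hα

lemma insertion_actLeft : insertion K e ≫ actLeft α = 𝟙 _ :=
  Outer.hom_ext fun x y => by
    change (α.hom (Outer.tmul K A x (generator e)) ⊗ₜ[K] 1 : Env K A) •
      Outer.tmul K A (generator e) y = Outer.tmul K A x y
    rw [hα, Outer.smul_tmul, one_smul]
    congr 1
    refine Subtype.ext ?_
    change (x * e : A) * e = x
    rw [S.mul_self_of_mem_leftIdeal, S.mul_self_of_mem_leftIdeal]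

lemma insertion_actRight : insertion K e ≫ actRight α = 𝟙 _ :=
  Outer.hom_ext fun x y => by
    change (1 ⊗ₜ[K] MulOpposite.op (α.hom (Outer.tmul K A (generator e) y)) : Env K A) •
      Outer.tmul K A x (generator e) = Outer.tmul K A x y
    rw [hα, Outer.smul_tmul, one_smul]
    congr 1
    refine Subtype.ext ?_
    change e * (e * y : A) = y
    rw [S.self_mul_of_mem_rightIdeal, S.self_mul_of_mem_rightIdeal]

end Actions

section Coactions

variable {β : regularBimod K A ⟶ idemBimod K e}
  (hβ : β.hom (1 : A) = ∑ l, Outer.tmul K A (S.left l) (S.right l))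

include hβ

lemma coactRight_contraction : coactRight β ≫ S.contraction = 𝟙 _ :=
  Outer.hom_ext fun x y => by
    have coact_tmul : (coactRight β).hom (Outer.tmul K A x y) =
        ∑ l, tensorMk₄ x y (S.left l) (S.right l) :=
      (congrArg (tensorMkHom _ _ _) hβ).trans (map_sum (tensorMkHom _ _ _) _ _)
    calc S.contraction.hom ((coactRight β).hom (Outer.tmul K A x y))
      _ = ∑ l, Outer.tmul K A x (S.form (y * S.left l) • S.right l) := by
        rw [coact_tmul, map_sum]; rfl
      _ = Outer.tmul K A x (∑ l, S.form (y * S.left l) • S.right l) :=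
        (map_sum (Outer.tmulHom (K := K) (A := A) (N := rightIdeal e) x) _ _).symm
      _ = Outer.tmul K A x y := by rw [S.sum_right]

lemma coactLeft_contraction : coactLeft β ≫ S.contraction = 𝟙 _ :=
  Outer.hom_ext fun x y => by
    have coact_tmul : (coactLeft β).hom (Outer.tmul K A x y) =
        ∑ l, tensorMk₄ (S.left l) (S.right l) x y :=
      (congrArg ((tensorMkHom _ _).flip _) hβ).trans (map_sum ((tensorMkHom _ _).flip _) _ _)
    calc S.contraction.hom ((coactLeft β).hom (Outer.tmul K A x y))
      _ = ∑ l, Outer.tmul K A (S.left l) (S.form (S.right l * x) • y) := by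
        rw [coact_tmul, map_sum]; rfl
      _ = ∑ l, Outer.tmul K A (S.form (S.right l * x) • S.left l) y := by
        simp only [Outer.smul_tmul_comm]
      _ = Outer.tmul K A (∑ l, S.form (S.right l * x) • S.left l) y :=
        (map_sum ((Outer.tmulHom (K := K) (A := A) (M := leftIdeal e)).flip y) _ _).symm
      _ = Outer.tmul K A x y := by rw [S.sum_left]

end Coactions

section Equivalences

variable {α : idemBimod K e ⟶ regularBimod K A} {β : regularBimod K A ⟶ idemBimod K e}
  (hα : ∀ (x : leftIdeal e) (y : rightIdeal e), α.hom (Outer.tmul K A x y) = (x * y : A))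
  (hβ : β.hom (1 : A) = ∑ l, Outer.tmul K A (S.left l) (S.right l))

/-- The contraction of the total complex of `(A e ⊗ e A ⟶ A) ⊗_A (A ⟶ A e ⊗ e A)` onto `A`. -/
def tensorDoubleContraction : ThreeTermContraction (biprod.lift (-coactRight β) α)
    (biprod.desc (actLeft α) β) (regularBimod K A) :=
  ThreeTermContraction.ofSquare (-S.contraction) (insertion K e)
    (by rw [Preadditive.neg_comp, coactRight_actLeft, neg_add_cancel])
    (by rw [Preadditive.neg_comp_neg, S.coactRight_contraction hβ])
    (S.insertion_actLeft hα)
    (by rw [Preadditive.comp_neg, S.insertion_contraction, neg_zero])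
    (by
      rw [Preadditive.neg_comp_neg]
      exact S.comp_eq_zero_of_contraction (S.coactRight_contraction hβ) (S.insertion_actLeft hα))

/-- The contraction of the total complex of `(A ⟶ A e ⊗ e A) ⊗_A (A e ⊗ e A ⟶ A)` onto `A`. -/
def tensorDoubleContraction' : ThreeTermContraction (biprod.lift (coactLeft β) α)
    (biprod.desc (-actRight α) β) (regularBimod K A) :=
  ThreeTermContraction.ofSquare S.contraction (-insertion K e)
    (by rw [Preadditive.comp_neg, coactLeft_actRight, neg_add_cancel])
    (S.coactLeft_contraction hβ)
    (by rw [Preadditive.neg_comp_neg, S.insertion_actRight hα])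
    (by rw [Preadditive.neg_comp, S.insertion_contraction, neg_zero])
    (by
      rw [Preadditive.neg_comp_neg]
      exact S.comp_eq_zero_of_contraction (S.coactLeft_contraction hβ) (S.insertion_actRight hα))

end Equivalences

end SphericalIdempotent

end SphericalIdempotents

section Perfectness

attribute [local instance] HasDerivedCategory.standard

section Complexes

variable {R : Type u} [Ring R]

lemma DerivedIso.of_homotopyEquiv {X Y : CochainComplex (ModuleCat.{u} R) ℤ}
    (h : HomotopyEquiv X Y) : DerivedIso X Y :=
  have : QuasiIso h.hom := h.quasiIso_hom
  ⟨asIso (DerivedCategory.Q.map h.hom)⟩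

lemma IsBounded.isPerfect {X : CochainComplex (ModuleCat.{u} R) ℤ} (h : IsBounded X)
    (hX : ∀ k, Module.Finite R (X.X k) ∧ Module.Projective R (X.X k)) : IsPerfect X :=
  ⟨X, h, hX, ⟨Iso.refl _⟩⟩

lemma isBounded_double {X₀ X₁ : ModuleCat.{u} R} (f : X₀ ⟶ X₁) {a b : ℤ}
    (hab : (ComplexShape.up ℤ).Rel a b) : IsBounded (HomologicalComplex.double f hab) := by
  have succ_eq : a + 1 = b := hab
  refine ⟨a, b, ?_, ?_⟩
  · rw [CochainComplex.isStrictlyGE_iff]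
    exact fun k hk => HomologicalComplex.isZero_double_X f hab k (by omega) (by omega)
  · rw [CochainComplex.isStrictlyLE_iff]
    exact fun k hk => HomologicalComplex.isZero_double_X f hab k (by omega) (by omega)

lemma IsBounded.map {S : Type u} [Ring S] {X : CochainComplex (ModuleCat.{u} R) ℤ}
    (h : IsBounded X) (G : ModuleCat.{u} R ⥤ ModuleCat.{u} S) [G.Additive] :
    IsBounded ((G.mapHomologicalComplex (ComplexShape.up ℤ)).obj X) := by
  obtain ⟨a, b, _, _⟩ := h
  exact ⟨a, b, inferInstance, inferInstance⟩

lemma finite_projective_of_linearEquiv {M N : Type u} [AddCommGroup M] [Module R M]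
    [AddCommGroup N] [Module R N] (e : M ≃ₗ[R] N) [Module.Finite R M] [Module.Projective R M] :
    Module.Finite R N ∧ Module.Projective R N :=
  ⟨Module.Finite.equiv e, Module.Projective.of_equiv e⟩

end Complexes

variable {K : Type u} [Field K] {A : Type u} [Ring A] [Algebra K A]

/-- A bimodule which is finitely generated and projective on both sides. -/
structure IsBiprojective (X : BimodCat K A) : Prop where
  left : Module.Finite A ((leftRes K A).obj X) ∧ Module.Projective A ((leftRes K A).obj X)
  right : Module.Finite Aᵐᵒᵖ ((rightRes K A).obj X) ∧ Module.Projective Aᵐᵒᵖ ((rightRes K A).obj X)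

namespace IsBiprojective

lemma of_iso {X Y : BimodCat K A} (h : IsBiprojective X) (e : X ≅ Y) : IsBiprojective Y := by
  obtain ⟨⟨_, _⟩, ⟨_, _⟩⟩ := h
  exact ⟨finite_projective_of_linearEquiv ((leftRes K A).mapIso e).toLinearEquiv,
    finite_projective_of_linearEquiv ((rightRes K A).mapIso e).toLinearEquiv⟩

lemma of_isZero {X : BimodCat K A} (h : Limits.IsZero X) : IsBiprojective X := by
  have := ModuleCat.subsingleton_of_isZero ((leftRes K A).map_isZero h)
  have := ModuleCat.subsingleton_of_isZero ((rightRes K A).map_isZero h)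
  exact ⟨⟨inferInstance, inferInstance⟩, ⟨inferInstance, inferInstance⟩⟩

variable (K A) in
lemma regularBimod : IsBiprojective (regularBimod K A) where
  left := finite_projective_of_linearEquiv
    (show A ≃ₗ[A] (leftRes K A).obj (NakayamaTilting.regularBimod K A) from
      { AddEquiv.refl A with
        map_smul' := fun a x => (congrArg (a * ·) (mul_one x)).symm })
  right := finite_projective_of_linearEquiv
    (show Aᵐᵒᵖ ≃ₗ[Aᵐᵒᵖ] (rightRes K A).obj (NakayamaTilting.regularBimod K A) from
      { MulOpposite.opAddEquiv.symm with
        map_smul' := fun a x => (one_mul (x.unop * a.unop)).symm })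

lemma double {X₀ X₁ : BimodCat K A} (h₀ : IsBiprojective X₀) (h₁ : IsBiprojective X₁)
    (f : X₀ ⟶ X₁) {a b : ℤ} (hab : (ComplexShape.up ℤ).Rel a b) (k : ℤ) :
    IsBiprojective ((HomologicalComplex.double f hab).X k) := by
  by_cases ha : k = a
  · subst ha
    exact h₀.of_iso (HomologicalComplex.doubleXIso₀ f hab).symm
  by_cases hb : k = b
  · subst hb
    exact h₁.of_iso (HomologicalComplex.doubleXIso₁ f hab (Ne.symm ha)).symm
  exact of_isZero (HomologicalComplex.isZero_double_X f hab k ha hb)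

end IsBiprojective

section Outer

variable (K A)
variable (M : Type u) [AddCommGroup M] [Module K M] [Module A M] [IsScalarTower K A M]
  (N : Type u) [AddCommGroup N] [Module K N] [Module Aᵐᵒᵖ N] [IsScalarTower K Aᵐᵒᵖ N]

/-- The restriction of `M ⊗_K N` to a left module. -/
def leftResOuterEquiv : M ⊗[K] N ≃ₗ[A] (leftRes K A).obj (outerBimod K A M N) :=
  { AddEquiv.refl (M ⊗[K] N) with
    map_smul' := fun a => LinearMap.congr_fun (TensorProduct.ext'
      (g := DistribSMul.toLinearMap K (M ⊗[K] N) a) (h := outerAction K A M N (a ⊗ₜ[K] 1))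
      fun x y => congrArg ((a • x) ⊗ₜ[K] ·) (one_smul Aᵐᵒᵖ y).symm) }

/-- The restriction of `M ⊗_K N` to a right module. -/
def rightResOuterEquiv : N ⊗[K] M ≃ₗ[Aᵐᵒᵖ] (rightRes K A).obj (outerBimod K A M N) :=
  { (TensorProduct.comm K N M).toAddEquiv with
    map_smul' := fun a => LinearMap.congr_fun (TensorProduct.ext'
      (g := (TensorProduct.comm K N M).toLinearMap ∘ₗ DistribSMul.toLinearMap K (N ⊗[K] M) a)
      (h := outerAction K A M N (1 ⊗ₜ[K] a) ∘ₗ (TensorProduct.comm K N M).toLinearMap)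
      fun y x => congrArg (· ⊗ₜ[K] (a • y)) (one_smul A x).symm) }

lemma isBiprojective_outerBimod [Module.Finite K M] [Module.Finite K N] [Module.Projective A M]
    [Module.Projective Aᵐᵒᵖ N] : IsBiprojective (outerBimod K A M N) := by
  have : Module.Finite A (M ⊗[K] N) := .of_restrictScalars_finite K A _
  have : Module.Finite Aᵐᵒᵖ (N ⊗[K] M) := .of_restrictScalars_finite K Aᵐᵒᵖ _
  exact ⟨finite_projective_of_linearEquiv (leftResOuterEquiv K A M N),
    finite_projective_of_linearEquiv (rightResOuterEquiv K A M N)⟩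

end Outer

section Biperfect

variable {P : BimodCpx K A} (hb : IsBounded P) (hP : ∀ k, IsBiprojective (P.X k))

include hb hP

lemma IsBounded.isBiperfect : IsBiperfect P :=
  ⟨hb, (hb.map _).isPerfect fun k => (hP k).left, (hb.map _).isPerfect fun k => (hP k).right⟩

lemma IsBounded.derivedTensorIso {Y Z : BimodCpx K A} (h : HomotopyEquiv (tensorCpx P Y) Z) :
    DerivedTensorIso P Y Z := by
  obtain ⟨_, b, _, hle⟩ := hb
  exact ⟨P, 𝟙 P, inferInstance, ⟨b, hle⟩, fun k => (hP k).right.2, .of_homotopyEquiv h⟩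

end Biperfect

lemma AreInverseTilting.symm {X Y : BimodCpx K A} (h : AreInverseTilting X Y) :
    AreInverseTilting Y X :=
  ⟨h.right, h.left, h.tensor_iso', h.tensor_iso⟩

namespace SphericalIdempotent

variable {e : A} {ι : Type} [Fintype ι] (S : SphericalIdempotent K e ι)

include S

lemma isBiprojective : IsBiprojective (idemBimod K e) :=
  have := S.finite_leftIdeal
  have := S.finite_rightIdeal
  have := S.projective_leftIdeal
  have := S.projective_rightIdeal
  isBiprojective_outerBimod K A (leftIdeal e) (rightIdeal e)

theorem areInverseTilting_double {α : idemBimod K e ⟶ regularBimod K A}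
    {β : regularBimod K A ⟶ idemBimod K e}
    (hα : ∀ (x : leftIdeal e) (y : rightIdeal e), α.hom (Outer.tmul K A x y) = (x * y : A))
    (hβ : β.hom (1 : A) = ∑ l, Outer.tmul K A (S.left l) (S.right l))
    (ha : (ComplexShape.up ℤ).Rel (-1) 0) (hb : (ComplexShape.up ℤ).Rel 0 1) :
    AreInverseTilting (HomologicalComplex.double α ha) (HomologicalComplex.double β hb) where
  left := (isBounded_double α ha).isBiperfect (S.isBiprojective.double (.regularBimod K A) α ha)
  right := (isBounded_double β hb).isBiperfect ((IsBiprojective.regularBimod K A).double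
    S.isBiprojective β hb)
  tensor_iso := (isBounded_double α ha).derivedTensorIso
    (S.isBiprojective.double (.regularBimod K A) α ha)
    ((ThreeTermModel.tensorDouble α β ha hb).homotopyEquivSingle (S.tensorDoubleContraction hα hβ))
  tensor_iso' := (isBounded_double β hb).derivedTensorIso
    ((IsBiprojective.regularBimod K A).double S.isBiprojective β hb)
    ((ThreeTermModel.tensorDouble' α β hb ha).homotopyEquivSingle
      (S.tensorDoubleContraction' hα hβ))

end SphericalIdempotent

end Perfectness

section Form

variable (K : Type u) [Field K] (n : ℕ) {m : ℕ} [NeZero m]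

variable (m) in
/-- The linear form on the path algebra which sums the coefficients of the paths of length `n`. -/
def pathForm : PathAlgebra K (ZMod m) →ₗ[K] K :=
  Finsupp.lift K K (AnyPath (ZMod m)) fun p => if p.2.2.length = n then 1 else 0

lemma pathForm_ofPath {a b : ZMod m} (p : Quiver.Path a b) :
    pathForm K n m (PathAlgebra.ofPath K p) = if p.length = n then 1 else 0 :=
  (Finsupp.sum_single_index (a := (⟨a, b, p⟩ : AnyPath (ZMod m))) (b := (1 : K))
    (h := fun q r => r • (if q.2.2.length = n then (1 : K) else 0)) (zero_smul K _)).trans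
    (one_smul K _)

lemma pathForm_ofPath_mul {a b : ZMod m} (p : Quiver.Path a b) (hp : n < p.length)
    (y : PathAlgebra K (ZMod m)) : pathForm K n m (PathAlgebra.ofPath K p * y) = 0 := by
  induction y using PathAlgebra.induction with
  | zero => rw [mul_zero, map_zero]
  | add y y' hy hy' => rw [mul_add, map_add, hy, hy', add_zero]
  | smul r y hy => rw [mul_smul_comm, map_smul, hy, smul_zero]
  | @path c d q =>
    by_cases h : b = c
    · subst h
      rw [PathAlgebra.ofPath_mul_ofPath, pathForm_ofPath, if_neg]
      rw [Quiver.Path.length_comp]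
      omega
    · rw [PathAlgebra.ofPath_mul_ofPath_of_ne _ _ h, map_zero]

lemma pathForm_mul_ofPath_mul {a b : ZMod m} (p : Quiver.Path a b) (hp : n < p.length)
    (x y : PathAlgebra K (ZMod m)) : pathForm K n m (x * PathAlgebra.ofPath K p * y) = 0 := by
  induction x using PathAlgebra.induction with
  | zero => rw [zero_mul, zero_mul, map_zero]
  | add x x' hx hx' => rw [add_mul, add_mul, map_add, hx, hx', add_zero]
  | smul r x hx => rw [smul_mul_assoc, smul_mul_assoc, map_smul, hx, smul_zero]
  | @path c d q =>
    by_cases h : d = a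
    · subst h
      rw [PathAlgebra.ofPath_mul_ofPath, pathForm_ofPath_mul]
      rw [Quiver.Path.length_comp]
      omega
    · rw [PathAlgebra.ofPath_mul_ofPath_of_ne _ _ h, zero_mul, map_zero]

lemma pathForm_eq_of_rel {x y : PathAlgebra K (ZMod m)}
    (h : RingQuot.Rel (NakayamaRel K n m) x y) (u v : PathAlgebra K (ZMod m)) :
    pathForm K n m (u * x * v) = pathForm K n m (u * y * v) := by
  induction h generalizing u v with
  | of h =>
    obtain ⟨p, hp⟩ := h
    rw [pathForm_mul_ofPath_mul K n p (by omega), mul_zero, zero_mul, map_zero]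
  | add_left _ ih => simp only [mul_add, add_mul, map_add, ih]
  | mul_left _ ih => simpa only [mul_assoc] using ih u (_ * v)
  | mul_right _ ih => simpa only [mul_assoc] using ih (u * _) v

/-- The function underlying `nakayamaForm`. -/
def nakayamaFormFun (x : Nakayama K n m) : K :=
  Quot.lift (pathForm K n m)
    (fun x y h => by simpa only [one_mul, mul_one] using pathForm_eq_of_rel K n h 1 1) x.toQuot

lemma nakayamaFormFun_mk (x : PathAlgebra K (ZMod m)) :
    nakayamaFormFun K n (RingQuot.mkAlgHom K (NakayamaRel K n m) x) = pathForm K n m x := by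
  simp only [RingQuot.mkAlgHom_def, RingQuot.mkRingHom_def]
  rfl

variable (m) in
/-- The linear form on `N^n_m` which sums the coefficients of the paths of length `n`. -/
def nakayamaForm : Nakayama K n m →ₗ[K] K where
  toFun := nakayamaFormFun K n
  map_add' x y := by
    obtain ⟨x, rfl⟩ := RingQuot.mkAlgHom_surjective K (NakayamaRel K n m) x
    obtain ⟨y, rfl⟩ := RingQuot.mkAlgHom_surjective K (NakayamaRel K n m) y
    rw [← map_add, nakayamaFormFun_mk, nakayamaFormFun_mk, nakayamaFormFun_mk, map_add]
  map_smul' r x := by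
    obtain ⟨x, rfl⟩ := RingQuot.mkAlgHom_surjective K (NakayamaRel K n m) x
    rw [← map_smul, nakayamaFormFun_mk, nakayamaFormFun_mk, map_smul, RingHom.id_apply]

lemma nakayamaForm_path (j : ZMod m) (l : ℕ) :
    nakayamaForm K n m (path K n m j l) = if l = n then 1 else 0 := by
  refine (nakayamaFormFun_mk K n _).trans ?_
  rw [pathForm_ofPath, length_walk]

lemma nakayamaForm_path_mul_path (j : ZMod m) (k : ℕ) {l : ℕ} (hl : l ≤ n) :
    nakayamaForm K n m (path K n m j k * path K n m (j + (l : ZMod m)) (n - l)) =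
      if k = l then 1 else 0 := by
  by_cases h : j + (k : ZMod m) = j + (l : ZMod m)
  · rw [path_mul_path K n j _ k _ h.symm, nakayamaForm_path]
    exact if_congr (by omega) rfl rfl
  · rw [path_mul_path_of_ne K n j _ k _ h, map_zero, if_neg]
    rintro rfl
    exact h rfl

end Form

lemma sum_dual_smul_eq_self {R V ι : Type*} [CommRing R] [AddCommGroup V] [Module R V] [Fintype ι]
    [DecidableEq ι] {v : ι → V} (hv : Submodule.span R (Set.range v) = ⊤) {f : ι → V →ₗ[R] R}
    (hf : ∀ k l, f l (v k) = if k = l then 1 else 0) (x : V) : ∑ l, f l x • v l = x := by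
  have sum_eq_id : ∑ l, (f l).smulRight (v l) = LinearMap.id :=
    LinearMap.ext_on_range hv fun k => by
      simp only [LinearMap.sum_apply, LinearMap.smulRight_apply, hf, ite_smul, one_smul, zero_smul,
        Finset.sum_ite_eq, Finset.mem_univ, if_true, LinearMap.id_apply]
  simpa only [LinearMap.sum_apply, LinearMap.smulRight_apply, LinearMap.id_apply] using
    LinearMap.congr_fun sum_eq_id x

section Cyclic

variable (K : Type u) [Field K] {n : ℕ} [NeZero n] (i : ZMod n)

/-- The path `p_l` of length `l` starting at `i`. -/
def startPath (l : Fin (n + 1)) : rightIdeal (idem K n n i) :=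
  ⟨path K n n i l, path_mem_rightP K n i l⟩

/-- The path `q_l` of length `n - l` ending at `i`. -/
def endPath (l : Fin (n + 1)) : leftIdeal (idem K n n i) :=
  ⟨path K n n (i + ((l : ℕ) : ZMod n)) (n - l), path_mem_leftP K n i _ _ (cycle_end i l)⟩

lemma idem_mul_path (j : ZMod n) (k : ℕ) :
    idem K n n i * path K n n j k = if j = i then path K n n i k else 0 := by
  split_ifs with h
  · rw [h]
    exact (path_mul_path K n i i 0 k (by simp)).trans (by rw [zero_add])
  · exact path_mul_path_of_ne K n i j 0 k (by simpa using Ne.symm h)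

lemma path_mul_idem (j : ZMod n) (k : ℕ) :
    path K n n j k * idem K n n i = if j + (k : ZMod n) = i then path K n n j k else 0 := by
  split_ifs with h
  · exact path_mul_path K n j i k 0 h.symm
  · exact path_mul_path_of_ne K n j i k 0 h

lemma span_range_startPath : Submodule.span K (Set.range (startPath K i)) = ⊤ := by
  suffices ∀ a : Nakayama K n n, MulOpposite.op a • generator (idem K n n i) ∈
      Submodule.span K (Set.range (startPath K i)) by
    refine top_unique fun y _ => ?_
    obtain ⟨a, ha⟩ := Submodule.mem_span_singleton.1 y.2
    exact (Subtype.ext ha : a • generator (idem K n n i) = y) ▸ this a.unop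
  intro a
  induction a using nakayama_induction with
  | zero => rw [MulOpposite.op_zero, zero_smul]; exact zero_mem _
  | add a b ha hb => rw [MulOpposite.op_add, add_smul]; exact add_mem ha hb
  | smul r a ha => rw [MulOpposite.op_smul, smul_assoc]; exact Submodule.smul_mem _ r ha
  | path j k =>
    by_cases h : j = i ∧ k < n + 1
    · refine Submodule.subset_span ⟨⟨k, h.2⟩, Subtype.ext ?_⟩
      exact ((idem_mul_path K i j k).trans (if_pos h.1)).symm
    · have eq_zero : MulOpposite.op (path K n n j k) • generator (idem K n n i) =
          (0 : rightIdeal (idem K n n i)) := by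
        refine Subtype.ext ((idem_mul_path K i j k).trans ?_)
        split_ifs with hj
        · exact path_eq_zero K n i k (not_lt.1 fun hk => h ⟨hj, hk⟩)
        · rfl
      rw [eq_zero]
      exact zero_mem _

lemma span_range_endPath : Submodule.span K (Set.range (endPath K i)) = ⊤ := by
  suffices ∀ a : Nakayama K n n, a • generator (idem K n n i) ∈
      Submodule.span K (Set.range (endPath K i)) by
    refine top_unique fun x _ => ?_
    obtain ⟨a, ha⟩ := Submodule.mem_span_singleton.1 x.2
    exact (Subtype.ext ha : a • generator (idem K n n i) = x) ▸ this a
  intro a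
  induction a using nakayama_induction with
  | zero => rw [zero_smul]; exact zero_mem _
  | add a b ha hb => rw [add_smul]; exact add_mem ha hb
  | smul r a ha => rw [smul_assoc]; exact Submodule.smul_mem _ r ha
  | path j k =>
    by_cases h : j + (k : ZMod n) = i ∧ k < n + 1
    · obtain ⟨rfl, hk⟩ := h
      refine Submodule.subset_span ⟨⟨n - k, by omega⟩, Subtype.ext ?_⟩
      have start_eq : j + (k : ZMod n) + ((n - k : ℕ) : ZMod n) = j := by
        rw [add_assoc, ← Nat.cast_add, Nat.add_sub_cancel' (by omega), ZMod.natCast_self, add_zero]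
      calc path K n n (j + (k : ZMod n) + ((n - k : ℕ) : ZMod n)) (n - (n - k))
        _ = path K n n j k := by rw [start_eq, Nat.sub_sub_self (by omega)]
        _ = path K n n j k * idem K n n (j + (k : ZMod n)) := by rw [path_mul_idem, if_pos rfl]
    · have eq_zero : path K n n j k • generator (idem K n n i) =
          (0 : leftIdeal (idem K n n i)) := by
        refine Subtype.ext ((path_mul_idem K i j k).trans ?_)
        split_ifs with hj
        · exact path_eq_zero K n j k (not_lt.1 fun hk => h ⟨hj, hk⟩)
        · rfl
      rw [eq_zero]
      exact zero_mem _

lemma nakayamaForm_startPath_mul_endPath (k l : Fin (n + 1)) :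
    nakayamaForm K n n (startPath K i k * endPath K i l) = if k = l then 1 else 0 :=
  (nakayamaForm_path_mul_path K n i k (Nat.lt_succ_iff.1 l.2)).trans
    (if_congr Fin.val_inj rfl rfl)

lemma exists_idem_mul_path_mul_idem_eq (j : ZMod n) (k : ℕ) :
    ∃ r : K, idem K n n i * path K n n j k * idem K n n i =
      nakayamaForm K n n (idem K n n i * path K n n j k * idem K n n i) • path K n n i n +
        r • idem K n n i := by
  rw [idem_mul_path]
  split_ifs with hj
  swap
  · exact ⟨0, by simp only [zero_mul, map_zero, zero_smul, add_zero]⟩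
  rw [path_mul_idem]
  split_ifs with hk
  swap
  · exact ⟨0, by simp only [map_zero, zero_smul, add_zero]⟩
  obtain ⟨q, rfl⟩ := (ZMod.natCast_eq_zero_iff k n).1 (by simpa using hk)
  rw [nakayamaForm_path]
  obtain rfl | rfl | hq : q = 0 ∨ q = 1 ∨ 2 ≤ q := by omega
  · refine ⟨1, ?_⟩
    rw [mul_zero, if_neg (NeZero.ne' n), zero_smul, zero_add, one_smul]
  · exact ⟨0, by rw [mul_one, if_pos rfl, one_smul, zero_smul, add_zero]⟩
  · have lt_mul : n < n * q := by nlinarith [NeZero.pos n]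
    refine ⟨0, ?_⟩
    rw [path_eq_zero K n i _ lt_mul, if_neg lt_mul.ne', zero_smul, zero_smul, add_zero]

lemma exists_idem_mul_mul_idem_eq (a : Nakayama K n n) :
    ∃ r : K, idem K n n i * a * idem K n n i =
      nakayamaForm K n n (idem K n n i * a * idem K n n i) • path K n n i n +
        r • idem K n n i := by
  induction a using nakayama_induction with
  | zero => exact ⟨0, by simp only [mul_zero, zero_mul, map_zero, zero_smul, add_zero]⟩
  | add a b ha hb =>
    obtain ⟨r, hr⟩ := ha
    obtain ⟨s, hs⟩ := hb
    refine ⟨r + s, ?_⟩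
    rw [mul_add, add_mul, map_add, add_smul, add_smul, add_add_add_comm, ← hr, ← hs]
  | smul t a ha =>
    obtain ⟨r, hr⟩ := ha
    refine ⟨t * r, ?_⟩
    rw [mul_smul_comm, smul_mul_assoc, map_smul, smul_assoc, mul_smul, ← smul_add, ← hr]
  | path j k => exact exists_idem_mul_path_mul_idem_eq K i j k

/-- The idempotent `(i)` of `N^n_n`. -/
def sphericalIdempotent : SphericalIdempotent K (idem K n n i) (Fin (n + 1)) where
  form := nakayamaForm K n n
  socle := ⟨path K n n i n, path_mem_rightP K n i n⟩
  left := endPath K i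
  right := startPath K i
  mul_self := (idem_mul_path K i i 0).trans (if_pos rfl)
  form_self := (nakayamaForm_path K n i 0).trans (if_neg (NeZero.ne' n))
  corner := exists_idem_mul_mul_idem_eq K i
  sum_left := sum_dual_smul_eq_self (span_range_endPath K i)
    (f := fun l => nakayamaForm K n n ∘ₗ LinearMap.mulLeft K (startPath K i l : Nakayama K n n) ∘ₗ
      (leftIdeal (idem K n n i)).subtype.restrictScalars K)
    fun k l => (nakayamaForm_startPath_mul_endPath K i l k).trans (if_congr eq_comm rfl rfl)
  sum_right := sum_dual_smul_eq_self (span_range_startPath K i)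
    (f := fun l => nakayamaForm K n n ∘ₗ LinearMap.mulRight K (endPath K i l : Nakayama K n n) ∘ₗ
      (rightIdeal (idem K n n i)).subtype.restrictScalars K)
    (nakayamaForm_startPath_mul_endPath K i)

theorem areInverseTilting_F_F' : AreInverseTilting (F K i) (F' K i) :=
  (sphericalIdempotent K i).areInverseTilting_double (alpha_tmul K n i) (beta_one K i) _ _

end Cyclic

end

end NakayamaTilting

theorem mainTheorem9 (K : Type u) [Field K] (n : ℕ) [NeZero n] (i : ZMod n) :
    NakayamaTilting.AreInverseTilting (NakayamaTilting.F K i) (NakayamaTilting.F' K i) ∧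
    NakayamaTilting.isoClass (NakayamaTilting.F K i) ∈
      NakayamaTilting.TrPic K (NakayamaTilting.Nakayama K n n) ∧
    NakayamaTilting.isoClass (NakayamaTilting.F' K i) ∈
      NakayamaTilting.TrPic K (NakayamaTilting.Nakayama K n n) := by
  have h := NakayamaTilting.areInverseTilting_F_F' K i
  exact ⟨h, ⟨_, ⟨_, h⟩, rfl⟩, ⟨_, ⟨_, h.symm⟩, rfl⟩⟩
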